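/- Let $K\subset S^3$ be a knot, $X=S^3\setminus K$, $\Gamma=\pi_1(X,x_0)$, let $\varepsilon:\Gamma\to\mathbb Z$ be a surjective homomorphism, and let $\rho:\Gamma\to U(V_\rho)$ be a unitary representation on a complex inner product space of finite dimension $m$. Let $$\Gamma=\langle x_1,\dots,x_k\mid r_1,\dots,r_{k-1}\rangle$$ be a Wirtinger presentation, with arcs numbered consecutively along the knot, so that $r_s$ is of the form $x_{o(s)}^{\pm1}x_s x_{o(s)}^{\mp1}x_{s+1}^{-1}$, and give $X$ (up to homotopy) the CW-structure derived from it: one vertex, an edge for each $x_i$, and a 2-cell attached along each $r_s$. Let $\tilde X$ be its universal covering, $C_\bullet(\tilde X)$ its cellular chain complex of free left $\mathbb C[\Gamma]$-modules, $C^\bullet(\tilde X)=\mathrm{Hom}_{\mathbb C[\Gamma]}(C_\bullet(\tilde X),\mathbb C[\Gamma])$, and $X_\infty$ the infinite cyclic covering corresponding to $\mathrm{Ker}\,\varepsilon$. Put $\Lambda=\mathbb C[t,t^{-1}]$ and $$C_\bullet(X_\infty,\rho)=C_\bullet(\tilde X)\otimes_{\mathbb C[\mathrm{Ker}\,\varepsilon]}V_\rho,\qquad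 C^\bullet(X_\infty,\rho)=C^\bullet(\tilde X)\otimes_{\mathbb C[\Gamma]}(\Lambda\otimes_{\mathbb C}V_\rho),$$ where $\gamma\in\Gamma$ acts on $\Lambda\otimes V_\rho$ by $\gamma(p\otimes v)=pt^{\varepsilon(\gamma)}\otimes\rho(\gamma)v$. Fix a unitary base $v_1,\dots,v_m$ of $V_\rho$ and lifts to $\tilde X$ of the cells of $X$, let $c^\alpha$ be the dual base of $C^\bullet(\tilde X)$, and give $C^\bullet(X_\infty,\rho)\otimes_\Lambda\mathbb C(t)$ the preferred base $c^\alpha\otimes v_j$. The Milnor–Reidemeister torsion $\tau$ of a based acyclic cochain complex $(C^\bullet,\delta)$ over $\mathbb C(t)$ is $$\tau=\pm\frac{\det(x_{odd},b_{odd})}{\det(x_{even},b_{even})},$$ where $b_{odd}$, $b_{even}$ are bases of the images of $\delta$ in odd and even degrees, $\delta x_{even}=b_{odd}$, $\delta x_{odd}=b_{even}$, and the determinants are taken with respect to the preferred bases; thus the torsion of $C^0\xrightarrow{\,f\,}C^1$ with $f$ invertible is $\pm\det f$. Let $\Phi:\mathbb C[F_k]\to M_m(\mathbb C(t))$ be the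 ring homomorphism with $\Phi(x_i)=t^{\varepsilon(x_i)}\rho(x_i)$ (matrices with respect to $v_1,\dots,v_m$). For $1\le j\le k$ let $A_j$ be the square block matrix obtained from $\bigl(\Phi(\partial r_s/\partial x_i)\bigr)_{s,i}$ (Fox derivatives; block rows indexed by relators, block columns by generators) by deleting the $j$-th block column, and let $\Delta_{K,\rho}=\det A_j/\det\Phi(x_j-1)$ be Kitano's twisted Alexander polynomial. **Theorem.** Suppose that all homology groups $H_i(X_\infty,\rho)$ of $C_\bullet(X_\infty,\rho)$ are finite dimensional complex vector spaces. Then, for every $j$, $\det\Phi(x_j-1)\ne0$ and $\det A_j\neq 0$; the torsion $\tau$ of $C^\bullet(X_\infty,\rho)\otimes_\Lambda\mathbb C(t)$ with respect to the preferred base is defined; and it is the inverse of the twisted Alexander polynomial, up to the indeterminacy of the torsion: $$\tau=z\,t^{l}\,\Delta_{K,\rho}^{-1}\qquad\text{for some } z\in\mathbb C,\ |z|=1,\ l\in\mathbb Z.$$ -/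

import Mathlib

open scoped TensorProduct LaurentPolynomial

namespace KnotTorsion

noncomputable section

/-! ### Knots and Wirtinger presentations -/

/-- The three dimensional sphere. -/
abbrev S3 : Type := Metric.sphere (0 : EuclideanSpace ℝ (Fin 4)) 1

/-- A knot: an embedded circle in the three dimensional sphere. -/
def IsKnot (K : Set S3) : Prop :=
  ∃ f : Circle → S3, Topology.IsEmbedding f ∧ Set.range f = K

/-- The Wirtinger relator `x_o ^ s * x_a * x_o ^ (-s) * x_b⁻¹` of a crossing, as a word: `o` is the
over-passing arc, `a` and `b` are the two arcs which meet under it, and `s` is the sign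
(`true` for `+1`, `false` for `-1`). -/
def crossingWord {α : Type*} (o : α) (s : Bool) (a b : α) : List (α × Bool) :=
  [(o, s), (a, true), (o, !s), (b, false)]

/-- A Wirtinger presentation `⟨x_0, …, x_n ∣ r_0, …, r_{n-1}⟩` of the group `Γ`.
The arcs are numbered in the order in which one meets them along the knot, so that the `s`-th
crossing separates the arcs `s` and `s + 1`.  The last crossing (between the arcs `n` and `0`) is
the one whose redundant relator is dropped.  The case `n = 0` is the unknot. -/
structure WirtingerPresentation (Γ : Type*) [Group Γ] (n : ℕ) where
  /-- the over-passing arc at a crossing -/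
  overArc : Fin n → Fin (n + 1)
  /-- the sign of a crossing -/
  sign : Fin n → Bool
  /-- the element of `Γ` represented by a generator -/
  gen : Fin (n + 1) → Γ
  /-- the generators generate `Γ` -/
  surjective_lift : Function.Surjective (FreeGroup.lift gen)
  /-- all relations between the generators follow from the relators -/
  ker_lift : (FreeGroup.lift gen).ker = Subgroup.normalClosure
    (Set.range fun s : Fin n =>
      FreeGroup.mk (crossingWord (overArc s) (sign s) s.castSucc s.succ))

/-- The relators, as words. -/
def WirtingerPresentation.rel {Γ : Type*} [Group Γ] {n : ℕ} (P : WirtingerPresentation Γ n)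
    (s : Fin n) : List (Fin (n + 1) × Bool) :=
  crossingWord (P.overArc s) (P.sign s) s.castSucc s.succ

/-! ### The chain complex of the universal covering

The CW-complex `X` derived from a presentation has one vertex, an edge for each generator
and a two-cell for each relator, attached along the relator.  The `i`-cells of its universal covering
are the translates `g • e_α` (`g ∈ Γ`) of fixed lifts `e_α` of the `i`-cells `α` of `X`: the vertices
of the covering are the elements `g` of `Γ`, the edge `g • e_i` goes from `g` to `g * x_i`, and the
two-cell `g • e_s` is attached along the lift, starting at the vertex `g`, of the loop `r_s`. -/

section UniversalCover

variable {Γ : Type*} [Group Γ]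

/-- The free left `ℂ[Γ]`-module of cellular chains of the universal covering, for a dimension in
which the cells of `X` are indexed by `ι`; the chain `g • e_α` is
`Pi.single α (MonoidAlgebra.of ℂ Γ g)`. -/
abbrev Chains (Γ : Type*) (ι : Type*) : Type _ := ι → MonoidAlgebra ℂ Γ

/-- The cell `g • e_α`. -/
def cell {ι : Type*} [DecidableEq ι] (g : Γ) (α : ι) : Chains Γ ι :=
  Pi.single α (MonoidAlgebra.of ℂ Γ g)

/-- The one-chain traversed by the lift, starting at the vertex `g`, of the edge path spelled by a
word in the generators and their inverses. -/
def liftedPath {ι : Type*} [DecidableEq ι] (x : ι → Γ) : Γ → List (ι × Bool) → Chains Γ ι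
  | _, [] => 0
  | g, (i, true) :: w => cell g i + liftedPath x (g * x i) w
  | g, (i, false) :: w => -cell (g * (x i)⁻¹) i + liftedPath x (g * (x i)⁻¹) w

variable {n : ℕ}

/-- The boundary of the edge `e_i` is its end point minus its initial point. -/
def boundary₁ (P : WirtingerPresentation Γ n) :
    Chains Γ (Fin (n + 1)) →ₗ[MonoidAlgebra ℂ Γ] Chains Γ (Fin 1) :=
  Fintype.linearCombination (MonoidAlgebra ℂ Γ) fun i => cell (P.gen i) 0 - cell 1 0

/-- The boundary of the two-cell `e_s` is the lift of the relator `r_s` starting at `1`. -/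
def boundary₂ (P : WirtingerPresentation Γ n) :
    Chains Γ (Fin n) →ₗ[MonoidAlgebra ℂ Γ] Chains Γ (Fin (n + 1)) :=
  Fintype.linearCombination (MonoidAlgebra ℂ Γ) fun s => liftedPath P.gen 1 (P.rel s)

/-- The action of `Γ` on the chains by deck transformations. -/
def deck (Γ : Type*) [Group Γ] (ι : Type*) : Γ →* Module.End ℂ (Chains Γ ι) where
  toFun g :=
    { toFun := fun c => MonoidAlgebra.of ℂ Γ g • c
      map_add' := fun c d => smul_add _ c d
      map_smul' := fun z c => by
        funext α
        simp }
  map_one' := by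
    ext1 c
    simp only [LinearMap.coe_mk, AddHom.coe_mk, map_one, Module.End.one_apply]
    exact one_smul _ c
  map_mul' g h := by
    ext1 c
    funext α
    simp only [LinearMap.coe_mk, AddHom.coe_mk, map_mul, Module.End.mul_apply, Pi.smul_apply,
      smul_eq_mul, mul_assoc]

/-- The cochains `Hom_{ℂ[Γ]}(C_i, ℂ[Γ])` of the universal covering. -/
abbrev Cochains (Γ : Type*) [Group Γ] (ι : Type*) : Type _ :=
  Chains Γ ι →ₗ[MonoidAlgebra ℂ Γ] MonoidAlgebra ℂ Γ

/-- The right `ℂ[Γ]`-module structure `(φ * a) c = φ c * a` of the cochains, written as the left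
action `g • φ = φ * g⁻¹` of `Γ`. -/
def codeck (Γ : Type*) [Group Γ] (ι : Type*) : Γ →* Module.End ℂ (Cochains Γ ι) where
  toFun g :=
    { toFun := fun φ =>
        { toFun := fun c => φ c * MonoidAlgebra.of ℂ Γ g⁻¹
          map_add' := fun c d => by rw [map_add, add_mul]
          map_smul' := fun a c => by
            rw [map_smul, RingHom.id_apply, smul_eq_mul, smul_eq_mul, mul_assoc] }
      map_add' := fun φ ψ => by
        ext1 c
        simp only [LinearMap.coe_mk, AddHom.coe_mk, LinearMap.add_apply, add_mul]
      map_smul' := fun z φ => by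
        ext1 c
        simp only [LinearMap.coe_mk, AddHom.coe_mk, LinearMap.smul_apply, smul_mul_assoc,
          RingHom.id_apply] }
  map_one' := by
    ext1 φ
    ext1 c
    simp only [LinearMap.coe_mk, AddHom.coe_mk, inv_one, map_one, mul_one, Module.End.one_apply]
  map_mul' g h := by
    ext1 φ
    ext1 c
    simp only [LinearMap.coe_mk, AddHom.coe_mk, mul_inv_rev, map_mul, Module.End.mul_apply,
      mul_assoc]

/-- The coboundary `φ ↦ φ ∘ ∂`. -/
def dualMap {ι κ : Type*} (d : Chains Γ ι →ₗ[MonoidAlgebra ℂ Γ] Chains Γ κ) :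
    Cochains Γ κ →ₗ[ℂ] Cochains Γ ι where
  toFun φ := φ.comp d
  map_add' _ _ := rfl
  map_smul' _ _ := rfl

/-- The basis of the cochains which is dual to the basis `g α • e_α` of the chains. -/
def dualCell {ι : Type*} (g : ι → Γ) (α : ι) : Cochains Γ ι where
  toFun c := c α * MonoidAlgebra.of ℂ Γ (g α)⁻¹
  map_add' c d := by rw [Pi.add_apply, add_mul]
  map_smul' a c := by
    rw [Pi.smul_apply, RingHom.id_apply, smul_eq_mul, smul_eq_mul, mul_assoc]

theorem dualCell_cell {ι : Type*} [DecidableEq ι] (g : ι → Γ) (α β : ι) :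
    dualCell g α (cell (g β) β) = if α = β then 1 else 0 := by
  by_cases h : α = β
  · subst h
    simp [dualCell, cell, MonoidAlgebra.one_def]
  · simp [dualCell, cell, h]

end UniversalCover

/-! ### Tensor products over a group ring -/

section Balanced

variable {G R W M M' : Type*} [Group G] [CommRing R] [Algebra ℂ R]
  [AddCommGroup W] [Module ℂ W] [Module R W] [IsScalarTower ℂ R W]
  [AddCommGroup M] [Module ℂ M] [AddCommGroup M'] [Module ℂ M']

/-- The relations `g w ⊗ g m = w ⊗ m`. -/
def balancedRel (σ : G →* Module.End R W) (μ : G →* Module.End ℂ M) : Submodule R (W ⊗[ℂ] M) :=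
  Submodule.span R {z | ∃ (g : G) (w : W) (m : M), z = σ g w ⊗ₜ[ℂ] μ g m - w ⊗ₜ[ℂ] m}

/-- The tensor product `M ⊗_{ℂ[G]} W` over the group ring, where `M` is regarded as a right module
through `m * g = g⁻¹ • m`, with the structure of an `R`-module which it inherits from `W`. -/
abbrev BalancedTensor (σ : G →* Module.End R W) (μ : G →* Module.End ℂ M) : Type _ :=
  (W ⊗[ℂ] M) ⧸ balancedRel σ μ

theorem balancedRel_le (σ : G →* Module.End R W) (μ : G →* Module.End ℂ M)
    (μ' : G →* Module.End ℂ M') (f : M →ₗ[ℂ] M') (hf : ∀ g m, f (μ g m) = μ' g (f m)) :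
    balancedRel σ μ ≤ (balancedRel σ μ').comap
      (TensorProduct.AlgebraTensorModule.map (LinearMap.id : W →ₗ[R] W) f) := by
  refine Submodule.span_le.2 ?_
  rintro _ ⟨g, w, m, rfl⟩
  refine Submodule.subset_span ⟨g, w, f m, ?_⟩
  simp [hf]

/-- The map `f ⊗ id` between tensor products over the group ring. -/
def balancedMap (σ : G →* Module.End R W) (μ : G →* Module.End ℂ M)
    (μ' : G →* Module.End ℂ M') (f : M →ₗ[ℂ] M') (hf : ∀ g m, f (μ g m) = μ' g (f m)) :
    BalancedTensor σ μ →ₗ[R] BalancedTensor σ μ' :=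
  Submodule.mapQ _ _ _ (balancedRel_le σ μ μ' f hf)

end Balanced

/-! ### The twisted complexes of the infinite cyclic covering -/

section Twisted

variable {Γ : Type*} [Group Γ] {n : ℕ} (P : WirtingerPresentation Γ n)
  (ε : Γ →* Multiplicative ℤ)
  {V : Type*} [NormedAddCommGroup V] [InnerProductSpace ℂ V] (ρ : Γ →* (V ≃ₗᵢ[ℂ] V))

/-- The unitary representation as a homomorphism to the linear endomorphisms. -/
def repEnd : Γ →* Module.End ℂ V where
  toFun g := (ρ g).toLinearEquiv.toLinearMap
  map_one' := by ext; simp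
  map_mul' g h := by ext; simp

/-- `C_i(X_∞, ρ) = C_i(X̃) ⊗_{ℂ[Ker ε]} V_ρ`. -/
abbrev CoverChains (ι : Type*) : Type _ :=
  BalancedTensor (R := ℂ) ((repEnd ρ).comp ε.ker.subtype) ((deck Γ ι).comp ε.ker.subtype)

theorem deck_comm {ι κ : Type*} (d : Chains Γ ι →ₗ[MonoidAlgebra ℂ Γ] Chains Γ κ)
    (g : Γ) (c : Chains Γ ι) :
    d (deck Γ ι g c) = deck Γ κ g (d c) :=
  d.map_smul _ _

/-- The differential of `C_•(X_∞, ρ)` induced by a boundary map of the universal covering. -/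
def coverMap {ι κ : Type*} (d : Chains Γ ι →ₗ[MonoidAlgebra ℂ Γ] Chains Γ κ) :
    CoverChains ε ρ ι →ₗ[ℂ] CoverChains ε ρ κ :=
  balancedMap _ _ _
    { toFun := d
      map_add' := d.map_add
      map_smul' := fun z c => by
        have h : z • c = algebraMap ℂ (MonoidAlgebra ℂ Γ) z • c := algebra_compatible_smul _ z c
        have h' : z • d c = algebraMap ℂ (MonoidAlgebra ℂ Γ) z • d c :=
          algebra_compatible_smul _ z (d c)
        rw [h, RingHom.id_apply, h', d.map_smul] }
    fun g c => deck_comm d g c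

/-- The homology groups `H_i(X_∞, ρ)`, `i = 0, 1, 2`, of the complex `C_•(X_∞, ρ)` are finite
dimensional complex vector spaces. -/
def FiniteHomology : Prop :=
  let d₁ := coverMap ε ρ (boundary₁ P)
  let d₂ := coverMap ε ρ (boundary₂ P)
  Module.Finite ℂ (CoverChains ε ρ (Fin 1) ⧸ LinearMap.range d₁) ∧
  Module.Finite ℂ (LinearMap.ker d₁ ⧸ (LinearMap.range d₂).comap (LinearMap.ker d₁).subtype) ∧
  Module.Finite ℂ (LinearMap.ker d₂)

/-- The `Γ`-module `Λ ⊗ V_ρ` over `Λ = ℂ[t, t⁻¹]`, with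
`γ (p ⊗ v) = p t ^ ε(γ) ⊗ ρ(γ) v`. -/
def laurentRep : Γ →* Module.End ℂ[T;T⁻¹] (ℂ[T;T⁻¹] ⊗[ℂ] V) where
  toFun g := (LaurentPolynomial.T (Multiplicative.toAdd (ε g)) : ℂ[T;T⁻¹]) •
    LinearMap.baseChange ℂ[T;T⁻¹] (repEnd ρ g)
  map_one' := by
    rw [map_one ε, map_one (repEnd ρ), toAdd_one, LaurentPolynomial.T_zero, one_smul]
    exact LinearMap.baseChange_id
  map_mul' g h := by
    rw [map_mul ε, map_mul (repEnd ρ), toAdd_mul, LaurentPolynomial.T_add, LinearMap.baseChange_mul]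
    exact (smul_mul_smul_comm _ _ _ _).symm

theorem laurentRep_tmul (g : Γ) (p : ℂ[T;T⁻¹]) (v : V) :
    laurentRep ε ρ g (p ⊗ₜ v) =
      (p * (LaurentPolynomial.T (Multiplicative.toAdd (ε g)) : ℂ[T;T⁻¹])) ⊗ₜ (ρ g v) := by
  change (LaurentPolynomial.T (Multiplicative.toAdd (ε g)) : ℂ[T;T⁻¹]) •
    LinearMap.baseChange ℂ[T;T⁻¹] (repEnd ρ g) (p ⊗ₜ v) = _
  rw [LinearMap.baseChange_tmul, TensorProduct.smul_tmul', smul_eq_mul, mul_comm]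
  rfl

/-- `C^i(X_∞, ρ) = C^i(X̃) ⊗_{ℂ[Γ]} (Λ ⊗ V_ρ)`, a `Λ`-module. -/
abbrev CoverCochains (ι : Type*) : Type _ :=
  BalancedTensor (laurentRep ε ρ) (codeck Γ ι)

/-- The differential of `C^•(X_∞, ρ)` induced by a boundary map of the universal covering. -/
def coverComap {ι κ : Type*} (d : Chains Γ ι →ₗ[MonoidAlgebra ℂ Γ] Chains Γ κ) :
    CoverCochains ε ρ κ →ₗ[ℂ[T;T⁻¹]] CoverCochains ε ρ ι :=
  balancedMap _ _ _ (dualMap d) fun _ _ => rfl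

/-- The field `ℂ(t)`, as the field of fractions of `Λ = ℂ[t, t⁻¹]`. -/
abbrev Ct : Type := FractionRing ℂ[T;T⁻¹]

/-- The `ℂ(t)`-vector space `C^i(X_∞, ρ) ⊗_Λ ℂ(t)`. -/
abbrev RationalCochains (ι : Type*) : Type _ := Ct ⊗[ℂ[T;T⁻¹]] CoverCochains ε ρ ι

/-- The differential of `C^•(X_∞, ρ) ⊗_Λ ℂ(t)`. -/
def rationalComap {ι κ : Type*} (d : Chains Γ ι →ₗ[MonoidAlgebra ℂ Γ] Chains Γ κ) :
    RationalCochains ε ρ κ →ₗ[Ct] RationalCochains ε ρ ι :=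
  (coverComap ε ρ d).baseChange Ct

/-- The preferred base `c^α ⊗ v_j`, where the `c^α` are dual to the lifts `g α • e_α` of the
cells and where the `v_j` form a unitary base of `V_ρ`. -/
def preferred {ι : Type*} (g : ι → Γ) {m : ℕ} (v : OrthonormalBasis (Fin m) ℂ V) (a : ι × Fin m) :
    RationalCochains ε ρ ι :=
  1 ⊗ₜ Submodule.Quotient.mk ((1 ⊗ₜ[ℂ] v a.2) ⊗ₜ[ℂ] dualCell g a.1)

end Twisted

/-! ### The Milnor-Reidemeister torsion -/

section Torsion

variable {F : Type*} [Field F]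

/-- `τ` is a value of the Milnor-Reidemeister torsion of the acyclic complex with even part `E`,
odd part `O`, differentials `dE : E → O` and `dO : O → E` and preferred bases `cE`, `cO`.  Let
`bE` be a base of the image `B_even` of `dO` and `bO` a base of the image `B_odd` of `dE`, and let
`xO`, `xE` be families with `dO xO = bE` and `dE xE = bO`.  Then
`τ = det (xO, bO) / det (xE, bE)`, the determinants being those of the coordinates with respect to
`cO` and `cE`.  The families are enumerated by arbitrary bijections `eE` and `eO`, so `τ` is
determined up to sign.

The exponent is normalised so that the torsion of a complex `C^0 → C^1` whose only differential is
an isomorphism `f` is `det f`. -/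
def IsFoldedTorsion {E O ι κ : Type*} [AddCommGroup E] [Module F E] [AddCommGroup O] [Module F O]
    [Fintype ι] [DecidableEq ι] [Fintype κ] [DecidableEq κ]
    (dE : E →ₗ[F] O) (dO : O →ₗ[F] E) (cE : ι → E) (cO : κ → O) (τ : F) : Prop :=
  ∃ (BE : Module.Basis ι F E) (BO : Module.Basis κ F O), ⇑BE = cE ∧ ⇑BO = cO ∧
  ∃ (p q : ℕ) (xE : Fin p → E) (bO : Fin p → O) (xO : Fin q → O) (bE : Fin q → E)
    (eE : ι ≃ Fin p ⊕ Fin q) (eO : κ ≃ Fin q ⊕ Fin p),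
    LinearIndependent F bE ∧ Submodule.span F (Set.range bE) = LinearMap.range dO ∧
    LinearIndependent F bO ∧ Submodule.span F (Set.range bO) = LinearMap.range dE ∧
    (∀ i, dO (xO i) = bE i) ∧ (∀ i, dE (xE i) = bO i) ∧
    τ = BO.det (Sum.elim xO bO ∘ eO) / BE.det (Sum.elim xE bE ∘ eE)

/-- `τ` is a value of the Milnor-Reidemeister torsion of a based acyclic cochain complex
`C^0 → C^1 → C^2`. -/
def IsTorsion {C₀ C₁ C₂ ι₀ ι₁ ι₂ : Type*} [AddCommGroup C₀] [Module F C₀]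
    [AddCommGroup C₁] [Module F C₁] [AddCommGroup C₂] [Module F C₂]
    [Fintype ι₀] [DecidableEq ι₀] [Fintype ι₁] [DecidableEq ι₁] [Fintype ι₂] [DecidableEq ι₂]
    (δ₀ : C₀ →ₗ[F] C₁) (δ₁ : C₁ →ₗ[F] C₂)
    (c₀ : ι₀ → C₀) (c₁ : ι₁ → C₁) (c₂ : ι₂ → C₂) (τ : F) : Prop :=
  IsFoldedTorsion (δ₀ ∘ₗ LinearMap.fst F C₀ C₂) (LinearMap.inr F C₀ C₂ ∘ₗ δ₁)
    (Sum.elim (fun i => (c₀ i, 0)) (fun i => (0, c₂ i)) : ι₀ ⊕ ι₂ → C₀ × C₂) c₁ τ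

variable {Γ : Type*} [Group Γ] {n : ℕ} (P : WirtingerPresentation Γ n)
  (ε : Γ →* Multiplicative ℤ)
  {V : Type*} [NormedAddCommGroup V] [InnerProductSpace ℂ V] (ρ : Γ →* (V ≃ₗᵢ[ℂ] V))

/-- `τ` is a value of the Milnor-Reidemeister torsion of `C^•(X_∞, ρ) ⊗_Λ ℂ(t)` with respect to
the preferred base given by the lifts `g₀`, `g₁`, `g₂` of the cells and the unitary base `v`. -/
def IsMilnorReidemeisterTorsion (g₀ : Fin 1 → Γ) (g₁ : Fin (n + 1) → Γ) (g₂ : Fin n → Γ)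
    {m : ℕ} (v : OrthonormalBasis (Fin m) ℂ V) (τ : Ct) : Prop :=
  IsTorsion (rationalComap ε ρ (boundary₁ P)) (rationalComap ε ρ (boundary₂ P))
    (preferred ε ρ g₀ v) (preferred ε ρ g₁ v) (preferred ε ρ g₂ v) τ

end Torsion

/-! ### The twisted Alexander polynomial -/

section Fox

variable {α : Type*} [DecidableEq α]

/-- The free derivative of a word with respect to the generator `i`, by the rules
`∂(x_i w) = 1 + x_i ∂w`, `∂(x_i⁻¹ w) = - x_i⁻¹ + x_i⁻¹ ∂w` and `∂(x_j^{±1} w) = x_j^{±1} ∂w`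
for `j ≠ i`. -/
def foxWord (i : α) : List (α × Bool) → MonoidAlgebra ℂ (FreeGroup α)
  | [] => 0
  | (j, true) :: w => (if j = i then 1 else 0) +
      MonoidAlgebra.of ℂ _ (FreeGroup.of j) * foxWord i w
  | (j, false) :: w => (if j = i then -MonoidAlgebra.of ℂ _ (FreeGroup.of j)⁻¹ else 0) +
      MonoidAlgebra.of ℂ _ (FreeGroup.of j)⁻¹ * foxWord i w

theorem foxWord_append (i : α) (u w : List (α × Bool)) :
    foxWord i (u ++ w) = foxWord i u + MonoidAlgebra.of ℂ _ (FreeGroup.mk u) * foxWord i w := by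
  induction u with
  | nil =>
    have h : (FreeGroup.mk ([] : List (α × Bool))) = 1 := rfl
    rw [h, map_one, one_mul, List.nil_append, foxWord, zero_add]
  | cons a u ih =>
    obtain ⟨j, b⟩ := a
    have h : FreeGroup.mk ((j, b) :: u) = FreeGroup.mk [(j, b)] * FreeGroup.mk u := rfl
    cases b
    · have h' : FreeGroup.mk [(j, false)] = (FreeGroup.of j)⁻¹ := rfl
      rw [List.cons_append, foxWord, foxWord, ih, h, h', map_mul, mul_add, add_assoc, mul_assoc]
    · have h' : FreeGroup.mk [(j, true)] = FreeGroup.of j := rfl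
      rw [List.cons_append, foxWord, foxWord, ih, h, h', map_mul, mul_add, add_assoc, mul_assoc]

theorem foxWord_step (i : α) {u w : List (α × Bool)} (h : FreeGroup.Red.Step u w) :
    foxWord i u = foxWord i w := by
  cases h with
  | @not L₁ L₂ j b =>
    rw [foxWord_append, foxWord_append]
    congr 2
    have h1 : (MonoidAlgebra.of ℂ (FreeGroup α) (FreeGroup.of j)) *
        MonoidAlgebra.of ℂ (FreeGroup α) (FreeGroup.of j)⁻¹ = 1 := by
      rw [← map_mul, mul_inv_cancel, map_one]
    have h2 : (MonoidAlgebra.of ℂ (FreeGroup α) (FreeGroup.of j)⁻¹) *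
        MonoidAlgebra.of ℂ (FreeGroup α) (FreeGroup.of j) = 1 := by
      rw [← map_mul, inv_mul_cancel, map_one]
    cases b
    · simp only [Bool.not_false, foxWord]
      rw [mul_add, ← mul_assoc, h2, one_mul]
      split_ifs <;> simp
    · simp only [Bool.not_true, foxWord]
      rw [mul_add, ← mul_assoc, h1, one_mul]
      split_ifs
      · rw [mul_neg, h1]; simp
      · simp

/-- Fox's free derivative `∂w / ∂x_i` in the group ring of the free group. -/
def foxDeriv (i : α) (w : FreeGroup α) : MonoidAlgebra ℂ (FreeGroup α) :=
  Quot.lift (foxWord i) (fun _ _ h => foxWord_step i h) w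

theorem foxDeriv_of (i j : α) : foxDeriv i (FreeGroup.of j) = if j = i then 1 else 0 := by
  change foxWord i [(j, true)] = _
  simp [foxWord]

theorem foxDeriv_mul (i : α) (u w : FreeGroup α) :
    foxDeriv i (u * w) = foxDeriv i u + MonoidAlgebra.of ℂ _ u * foxDeriv i w := by
  induction u using Quot.inductionOn
  induction w using Quot.inductionOn
  exact foxWord_append i _ _

end Fox

section Alexander

variable {Γ : Type*} [Group Γ] {n : ℕ} (P : WirtingerPresentation Γ n)
  (ε : Γ →* Multiplicative ℤ)
  {V : Type*} [NormedAddCommGroup V] [InnerProductSpace ℂ V] (ρ : Γ →* (V ≃ₗᵢ[ℂ] V))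
  {m : ℕ} (v : OrthonormalBasis (Fin m) ℂ V)

/-- `ρ ⊗ ε` on `Γ`: the matrix `t ^ ε(γ) ρ(γ)` with respect to the base `v`. -/
def matrixRep : Γ →* Matrix (Fin m) (Fin m) ℂ[T;T⁻¹] where
  toFun g := (LaurentPolynomial.T (Multiplicative.toAdd (ε g)) : ℂ[T;T⁻¹]) •
    (LinearMap.toMatrix v.toBasis v.toBasis (repEnd ρ g)).map LaurentPolynomial.C
  map_one' := by
    rw [map_one ε, map_one (repEnd ρ), toAdd_one, LaurentPolynomial.T_zero, one_smul, LinearMap.toMatrix_one]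
    exact Matrix.map_one _ (map_zero _) (map_one _)
  map_mul' g h := by
    rw [map_mul ε, map_mul (repEnd ρ), toAdd_mul, LaurentPolynomial.T_add, LinearMap.toMatrix_mul,
      Matrix.map_mul]
    exact (smul_mul_smul_comm _ _ _ _).symm

/-- The homomorphism `Φ : ℂ[F_k] → M_m(Λ) ⊆ M_m(ℂ(t))` induced by `ρ ⊗ ε`. -/
def Phi : MonoidAlgebra ℂ (FreeGroup (Fin (n + 1))) →ₐ[ℂ] Matrix (Fin m) (Fin m) ℂ[T;T⁻¹] :=
  MonoidAlgebra.lift ℂ _ _ ((matrixRep ε ρ v).comp (FreeGroup.lift P.gen))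

/-- The Alexander matrix `(Φ(∂r_s / ∂x_i))` with the blocks of the generator `x_j` removed; it is
square of size `m n`, with the block rows indexed by the relators. -/
def alexanderMatrix (j : Fin (n + 1)) : Matrix (Fin n × Fin m) (Fin n × Fin m) ℂ[T;T⁻¹] :=
  Matrix.of fun a b =>
    Phi P ε ρ v (foxDeriv (j.succAbove b.1) (FreeGroup.mk (P.rel a.1))) a.2 b.2

/-- The matrix `Φ(x_j - 1)`. -/
def genMatrix (j : Fin (n + 1)) : Matrix (Fin m) (Fin m) ℂ[T;T⁻¹] :=
  Phi P ε ρ v (MonoidAlgebra.of ℂ _ (FreeGroup.of j) - 1)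

/-- The twisted Alexander polynomial `det A_j / det Φ(x_j - 1)`. -/
def twistedAlexander (j : Fin (n + 1)) : Ct :=
  algebraMap ℂ[T;T⁻¹] Ct (alexanderMatrix P ε ρ v j).det /
    algebraMap ℂ[T;T⁻¹] Ct (genMatrix P ε ρ v j).det

end Alexander

end

end KnotTorsion

open KnotTorsion

namespace KnotTorsion

noncomputable section

/-! ### Torsion of a based three-term complex as a quotient of two minors. -/

section AbstractTorsion

variable {F C₀ C₁ C₂ ι₀ ι₁ ι₂ : Type*} [Field F] [AddCommGroup C₀] [Module F C₀]
  [AddCommGroup C₁] [Module F C₁] [AddCommGroup C₂] [Module F C₂]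

/-! In the preferred bases, the complex `C^0 → C^1 → C^2` has as its differentials the column of
blocks `Φ(x_i - 1)` and the Fox matrix `(Φ(∂r_s/∂x_i))`, up to block diagonal factors coming from
the choice of lifts. The blocks of these factors are matrices `t^ε(γ) ρ(γ)`, with determinants `z
t^l`, `|z| = 1`.

Split `C^1` into the part of the edge `x_j` and the part of the other edges. If the minor `X` of the
first differential on the edge `x_j` and the minor `A` of the second on the other edges are both
invertible, linear algebra gives torsion `± det X / det A` (`IsTorsion.eq_sign_mul_div`). Up to the
factors above, `det X` is `det Φ(x_j - 1)` and `det A` is `det A_j`, so the torsion is the inverse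
of the twisted Alexander polynomial.

It remains to see that the two determinants do not vanish. Consecutive Wirtinger generators are
conjugate, so all have the same `ε`, which is nontrivial since `ε` is onto; as `ρ` is unitary,
`t^ε(x_j) ρ(x_j)` has no eigenvalue `1` at `t = 2` (`det_matrixRep_sub_one_ne_zero`). For `A_j`, the
chains `C_i(X_∞, ρ)` form free `Λ`-modules, with boundary matrices the conjugate transposes of the
coboundary matrices. A vector killed by the conjugate transpose of `A_j` gives a 2-chain whose
boundary lives on `x_j` alone; `∂₁∂₂ = 0` and the first determinant make it a cycle. Cycles form a
finite dimensional `Λ`-submodule of a free module, hence zero (`coordMap_injective`,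
`det_alexanderMatrix_ne_zero`). -/

theorem prod_basis_eq_elim (B₀ : Module.Basis ι₀ F C₀) (B₂ : Module.Basis ι₂ F C₂) :
    ⇑(B₀.prod B₂) = Sum.elim (fun i => (B₀ i, 0)) (fun i => (0, B₂ i)) := by
  funext i
  cases i <;> simp

theorem det_comp_equiv {ι κ M : Type*} [Fintype ι] [DecidableEq ι] [AddCommGroup M] [Module F M]
    (B : Module.Basis ι F M) (u : κ → M) (e f : ι ≃ κ) :
    ∃ s : ℤˣ, B.det (u ∘ e) = ((s : ℤ) : F) * B.det (u ∘ f) := by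
  refine ⟨Equiv.Perm.sign (e.trans f.symm), ?_⟩
  have h : u ∘ e = (u ∘ f) ∘ (e.trans f.symm) := by
    funext i
    simp
  rw [h, AlternatingMap.map_perm, Units.smul_def, zsmul_eq_mul]

theorem det_ne_zero_of_linearIndependent {ι M : Type*} [Fintype ι] [DecidableEq ι]
    [AddCommGroup M] [Module F M] (B : Module.Basis ι F M) {u : ι → M}
    (hu : LinearIndependent F u) : B.det u ≠ 0 := by
  have : Module.Finite F M := Module.Finite.of_basis B
  have h : Submodule.span F (Set.range u) = ⊤ :=
    hu.span_eq_top_of_card_eq_finrank' (Module.finrank_eq_card_basis B).symm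
  exact ((B.is_basis_iff_det).1 ⟨hu, h⟩).ne_zero

variable (δ₀ : C₀ →ₗ[F] C₁) (δ₁ : C₁ →ₗ[F] C₂) (B₀ : Module.Basis ι₀ F C₀)
  (B₁ : Module.Basis ι₁ F C₁) (B₂ : Module.Basis ι₂ F C₂) (e : ι₁ ≃ ι₀ ⊕ ι₂)

theorem injective_of_det_ne_zero [Fintype ι₀] [DecidableEq ι₀] [Fintype ι₁]
    (hX : ((LinearMap.toMatrix B₀ B₁ δ₀).submatrix (fun i => e.symm (.inl i)) id).det ≠ 0) :
    LinearMap.ker δ₀ = ⊥ := by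
  rw [LinearMap.ker_eq_bot']
  intro c hc
  by_contra hne
  refine hX (Matrix.exists_mulVec_eq_zero_iff.1 ⟨B₀.repr c, ?_, ?_⟩)
  · intro h
    apply hne
    have h' : B₀.repr c = 0 := DFunLike.coe_injective h
    simpa using h'
  · funext i
    have h := congrFun (LinearMap.toMatrix_mulVec_repr B₀ B₁ δ₀ c) (e.symm (.inl i))
    rw [hc] at h
    simpa [Matrix.mulVec, dotProduct] using h

theorem linearIndependent_of_det_ne_zero [Fintype ι₁] [DecidableEq ι₁] [Fintype ι₂]
    [DecidableEq ι₂]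
    (hA : ((LinearMap.toMatrix B₁ B₂ δ₁).submatrix id (fun i => e.symm (.inr i))).det ≠ 0) :
    LinearIndependent F (fun i => δ₁ (B₁ (e.symm (.inr i)))) ∧
      Submodule.span F (Set.range fun i => δ₁ (B₁ (e.symm (.inr i)))) = ⊤ := by
  rw [B₂.is_basis_iff_det, isUnit_iff_ne_zero, Module.Basis.det_apply]
  convert hA using 2
  ext i j
  simp [Module.Basis.toMatrix_apply, LinearMap.toMatrix_apply]

variable [Fintype ι₀] [DecidableEq ι₀] [Fintype ι₁] [DecidableEq ι₁] [Fintype ι₂] [DecidableEq ι₂]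

/-- The base of `C^0` serves as `x_even`, and the base vectors of `C^1` in the second part of the
splitting serve as `x_odd`. The minors make `δ₀` injective and the images of the latter a base of
`C^2`. -/
theorem exists_isTorsion
    (hX : ((LinearMap.toMatrix B₀ B₁ δ₀).submatrix (fun i => e.symm (.inl i)) id).det ≠ 0)
    (hA : ((LinearMap.toMatrix B₁ B₂ δ₁).submatrix id (fun i => e.symm (.inr i))).det ≠ 0) :
    ∃ τ, IsTorsion δ₀ δ₁ B₀ B₁ B₂ τ := by
  have hinj := injective_of_det_ne_zero δ₀ B₀ B₁ e hX
  obtain ⟨hli, hsp⟩ := linearIndependent_of_det_ne_zero δ₁ B₁ B₂ e hA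
  let f₀ := Fintype.equivFin ι₀
  let f₂ := Fintype.equivFin ι₂
  refine ⟨_, B₀.prod B₂, B₁, prod_basis_eq_elim B₀ B₂, rfl, Fintype.card ι₀, Fintype.card ι₂,
    fun i => (B₀ (f₀.symm i), 0), fun i => δ₀ (B₀ (f₀.symm i)),
    fun i => B₁ (e.symm (.inr (f₂.symm i))),
    fun i => (0, δ₁ (B₁ (e.symm (.inr (f₂.symm i))))),
    Equiv.sumCongr f₀ f₂, e.trans ((Equiv.sumComm _ _).trans (Equiv.sumCongr f₂ f₀)),
    ?_, ?_, ?_, ?_, fun i => rfl, fun i => rfl, rfl⟩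
  · exact (hli.comp _ f₂.symm.injective).map' (LinearMap.inr F C₀ C₂)
      (LinearMap.ker_eq_bot.2 LinearMap.inr_injective)
  · have h : (Set.range fun i => ((0 : C₀), δ₁ (B₁ (e.symm (.inr (f₂.symm i)))))) =
        LinearMap.inr F C₀ C₂ '' Set.range fun i => δ₁ (B₁ (e.symm (.inr i))) := by
      rw [← Set.range_comp, ← f₂.symm.surjective.range_comp]
      rfl
    have h' : LinearMap.range δ₁ = ⊤ := by
      rw [eq_top_iff, ← hsp, Submodule.span_le]
      rintro _ ⟨i, rfl⟩
      exact ⟨_, rfl⟩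
    rw [h, Submodule.span_image, hsp, LinearMap.range_comp, h']
  · exact (B₀.linearIndependent.comp _ f₀.symm.injective).map' δ₀ hinj
  · have h : (Set.range fun i => δ₀ (B₀ (f₀.symm i))) = δ₀ '' Set.range B₀ := by
      rw [← Set.range_comp, ← f₀.symm.surjective.range_comp]
      rfl
    rw [h, Submodule.span_image, B₀.span_eq, LinearMap.range_comp, Submodule.range_fst]

/-- For arbitrary admissible families, `det (x_even, b_even)` is block triangular with determinant
`det a * det w`, and multiplying `(b_odd, x_odd)` by a matrix of determinant `det A` yields a block
triangular matrix of determinant `det X * det a * det w`. The auxiliary `a` and `w` cancel in the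
quotient. -/
theorem IsTorsion.eq_sign_mul_div {τ : F} (hτ : IsTorsion δ₀ δ₁ B₀ B₁ B₂ τ)
    (hδ : δ₁ ∘ₗ δ₀ = 0)
    (hX : ((LinearMap.toMatrix B₀ B₁ δ₀).submatrix (fun i => e.symm (.inl i)) id).det ≠ 0)
    (hA : ((LinearMap.toMatrix B₁ B₂ δ₁).submatrix id (fun i => e.symm (.inr i))).det ≠ 0) :
    ∃ s : ℤˣ, τ = ((s : ℤ) : F) *
      (((LinearMap.toMatrix B₀ B₁ δ₀).submatrix (fun i => e.symm (.inl i)) id).det /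
        ((LinearMap.toMatrix B₁ B₂ δ₁).submatrix id (fun i => e.symm (.inr i))).det) := by
  have hinj := injective_of_det_ne_zero δ₀ B₀ B₁ e hX
  obtain ⟨BE, BO, hBE, hBO, p, q, xE, bO, xO, bE, eE, eO, hbE, -, hbO, hspO, hxO, hxE, rfl⟩ := hτ
  obtain rfl : BE = B₀.prod B₂ :=
    Module.Basis.eq_of_apply_eq fun i => by rw [hBE, prod_basis_eq_elim]
  obtain rfl : B₁ = BO := Module.Basis.eq_of_apply_eq fun i => by rw [hBO]
  -- The size of `bO` is the rank of the injective map `δ₀`; that of `bE` then follows by counting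
  -- the even part.
  have hp : Fintype.card ι₀ = p := by
    have h1 := finrank_span_eq_card hbO
    rw [hspO, LinearMap.range_comp, Submodule.range_fst, ← LinearMap.range_eq_map,
      LinearMap.finrank_range_of_inj (LinearMap.ker_eq_bot.1 hinj),
      Module.finrank_eq_card_basis B₀, Fintype.card_fin] at h1
    exact h1
  have hq : Fintype.card ι₂ = q := by
    have h := Fintype.card_congr eE
    simp only [Fintype.card_sum, Fintype.card_fin] at h
    omega
  let f₀ : ι₀ ≃ Fin p := Fintype.equivFinOfCardEq hp
  let f₂ : ι₂ ≃ Fin q := Fintype.equivFinOfCardEq hq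
  have hxE' : ∀ i, δ₀ (xE i).1 = bO i := hxE
  have hxO' : ∀ i, (0, δ₁ (xO i)) = bE i := hxO
  let a : Matrix ι₀ ι₀ F := B₀.toMatrix fun i => (xE (f₀ i)).1
  let w : Matrix ι₂ ι₂ F := B₂.toMatrix fun i => δ₁ (xO (f₂ i))
  have ha : a.det ≠ 0 := by
    refine det_ne_zero_of_linearIndependent B₀ ?_
    have h : LinearIndependent F (fun i => (xE i).1) := by
      apply LinearIndependent.of_comp δ₀
      convert hbO using 1
      exact funext hxE'
    exact h.comp _ f₀.injective
  have hw : w.det ≠ 0 := by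
    refine det_ne_zero_of_linearIndependent B₂ ?_
    have h : LinearIndependent F (fun i => δ₁ (xO i)) := by
      have h' : LinearMap.inr F C₀ C₂ ∘ (fun i => δ₁ (xO i)) = bE := funext hxO'
      exact LinearIndependent.of_comp (LinearMap.inr F C₀ C₂) (h' ▸ hbE)
    exact h.comp _ f₂.injective
  -- The given enumerations are exchanged for those adapted to the splitting, at the price of signs.
  obtain ⟨s₁, hs₁⟩ := det_comp_equiv (B₀.prod B₂) (Sum.elim xE bE) eE (Equiv.sumCongr f₀ f₂)
  obtain ⟨s₂, hs₂⟩ := det_comp_equiv B₁ (Sum.elim xO bO) eO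
    (e.trans ((Equiv.sumCongr f₀ f₂).trans (Equiv.sumComm _ _)))
  have hE : (B₀.prod B₂).det (Sum.elim xE bE ∘ Equiv.sumCongr f₀ f₂) = a.det * w.det := by
    have h : (B₀.prod B₂).toMatrix (Sum.elim xE bE ∘ Equiv.sumCongr f₀ f₂) =
        Matrix.fromBlocks a 0 (B₂.toMatrix fun i => (xE (f₀ i)).2) w := by
      ext (i | i) (j | j) <;> simp [Module.Basis.toMatrix_apply, a, w, ← hxO']
    rw [Module.Basis.det_apply, h, Matrix.det_fromBlocks_zero₁₂]
  set M₀ := LinearMap.toMatrix B₀ B₁ δ₀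
  set M₁ := LinearMap.toMatrix B₁ B₂ δ₁
  set X := M₀.submatrix (fun i => e.symm (.inl i)) id
  set A := M₁.submatrix id (fun i => e.symm (.inr i))
  let Y : Matrix ι₁ ι₁ F := B₁.toMatrix (Sum.elim xO bO ∘
    (e.trans ((Equiv.sumCongr f₀ f₂).trans (Equiv.sumComm _ _))))
  have hM₁ (c : C₁) (i : ι₂) : ∑ k, M₁ i k * B₁.repr c k = B₂.repr (δ₁ c) i :=
    congrFun (LinearMap.toMatrix_mulVec_repr B₁ B₂ δ₁ c) i
  have hM₀ (c : C₀) (i : ι₁) : ∑ k, M₀ i k * B₀.repr c k = B₁.repr (δ₀ c) i :=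
    congrFun (LinearMap.toMatrix_mulVec_repr B₀ B₁ δ₀ c) i
  have hsplit (c : C₁) (i : ι₂) : ∑ k, M₁ i (e.symm (.inl k)) * B₁.repr c (e.symm (.inl k)) +
      ∑ k, M₁ i (e.symm (.inr k)) * B₁.repr c (e.symm (.inr k)) = B₂.repr (δ₁ c) i := by
    rw [← hM₁, ← e.symm.sum_comp, Fintype.sum_sum_type]
  have hzero (i) : δ₁ (bO i) = 0 := by
    rw [← hxE']
    exact LinearMap.congr_fun hδ _
  -- The left factor keeps the coordinates in the first part of `C^1` and replaces the others by
  -- those of the image under `δ₁`. The lower left block vanishes because `δ₁ bO = δ₁ δ₀ xE = 0`.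
  have hY : Matrix.fromBlocks 1 0 (M₁.submatrix id fun i => e.symm (.inl i)) A *
      Y.submatrix e.symm e.symm = Matrix.fromBlocks (X * a)
        (Matrix.of fun i k => B₁.repr (xO (f₂ k)) (e.symm (.inl i))) 0 w := by
    ext (i | i) (j | j)
    · simp [Matrix.mul_apply, Y, Module.Basis.toMatrix_apply, Matrix.one_apply, X, a, hM₀, hxE']
    · simp [Matrix.mul_apply, Y, Module.Basis.toMatrix_apply, Matrix.one_apply]
    · simp [Matrix.mul_apply, Y, Module.Basis.toMatrix_apply, A, hsplit, hzero]
    · simp [Matrix.mul_apply, Y, Module.Basis.toMatrix_apply, A, hsplit, w]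
  have hdet := congrArg Matrix.det hY
  rw [Matrix.det_mul, Matrix.det_fromBlocks_zero₁₂, Matrix.det_fromBlocks_zero₂₁, Matrix.det_one,
    one_mul, Matrix.det_submatrix_equiv_self, Matrix.det_mul] at hdet
  have hYdet : B₁.det (Sum.elim xO bO ∘
      (e.trans ((Equiv.sumCongr f₀ f₂).trans (Equiv.sumComm _ _)))) = Y.det := rfl
  refine ⟨s₂ * s₁, ?_⟩
  rw [hs₁, hs₂, hE, hYdet]
  have hs₁' : (((s₁ : ℤ) : F)) * (s₁ : ℤ) = 1 := by
    rw [← Int.cast_mul, Int.units_coe_mul_self, Int.cast_one]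
  have hs₁ne : (((s₁ : ℤ) : F)) ≠ 0 := left_ne_zero_of_mul_eq_one hs₁'
  rw [Units.val_mul, Int.cast_mul, mul_div_assoc', div_eq_div_iff (by positivity) hA]
  linear_combination ((s₂ : ℤ) : F) * hdet -
    ((s₂ : ℤ) : F) * X.det * a.det * w.det * hs₁'

end AbstractTorsion

/-! ### Fox calculus as path lifting, and the abelianised Wirtinger relations. -/

section Words

variable {Γ : Type*} [Group Γ] {ι : Type*}

/-- The ring homomorphism `ℂ[F_k] → ℂ[Γ]` given by the generators `x`. -/
def groupRingLift (x : ι → Γ) : MonoidAlgebra ℂ (FreeGroup ι) →ₐ[ℂ] MonoidAlgebra ℂ Γ :=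
  MonoidAlgebra.lift ℂ _ _ ((MonoidAlgebra.of ℂ Γ).comp (FreeGroup.lift x))

@[simp]
theorem groupRingLift_of (x : ι → Γ) (w : FreeGroup ι) :
    groupRingLift x (MonoidAlgebra.of ℂ _ w) = MonoidAlgebra.of ℂ Γ (FreeGroup.lift x w) :=
  MonoidAlgebra.lift_of ..

variable [DecidableEq ι]

theorem cell_apply (g : Γ) (i j : ι) :
    cell g i j = if i = j then MonoidAlgebra.of ℂ Γ g else 0 := by
  simp [cell, Pi.single_apply, eq_comm]

/-- The recursion for Fox derivatives is path lifting read on coefficients: `x_j` adds the edge at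
the current vertex, while `x_j⁻¹` runs backwards along the edge that starts at the next vertex,
whence the term `-x_j⁻¹`. -/
theorem liftedPath_apply (x : ι → Γ) (g : Γ) (w : List (ι × Bool)) (i : ι) :
    liftedPath x g w i = MonoidAlgebra.of ℂ Γ g * groupRingLift x (foxWord i w) := by
  induction w generalizing g with
  | nil => simp [liftedPath, foxWord]
  | cons a w ih =>
    obtain ⟨j, b⟩ := a
    cases b
    · rw [liftedPath, Pi.add_apply, ih, foxWord, map_add (groupRingLift x),
        map_mul (groupRingLift x), groupRingLift_of, map_inv (FreeGroup.lift x), FreeGroup.lift_apply_of, Pi.neg_apply,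
        cell_apply, map_mul, mul_add, mul_assoc]
      congr 1
      split_ifs
      · rw [map_neg, groupRingLift_of, map_inv (FreeGroup.lift x), FreeGroup.lift_apply_of, mul_neg]
      · simp
    · rw [liftedPath, Pi.add_apply, ih, foxWord, map_add (groupRingLift x),
        map_mul (groupRingLift x), groupRingLift_of, FreeGroup.lift_apply_of, cell_apply, map_mul, mul_add, mul_assoc]
      congr 1
      split_ifs <;> simp

variable {n : ℕ} (P : WirtingerPresentation Γ n)

theorem boundary₁_cell (g : Γ) (i : Fin (n + 1)) :
    boundary₁ P (cell g i) = cell (g * P.gen i) 0 - cell g 0 := by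
  rw [boundary₁, cell.eq_def g i, Fintype.linearCombination_apply_single]
  funext k
  simp [cell_apply, Subsingleton.elim (0 : Fin 1) k, mul_sub]

theorem boundary₂_cell (g : Γ) (s : Fin n) :
    boundary₂ P (cell g s) = MonoidAlgebra.of ℂ Γ g • liftedPath P.gen 1 (P.rel s) := by
  rw [boundary₂, cell, Fintype.linearCombination_apply_single]

theorem boundary₁_cell_one_apply (i : Fin (n + 1)) (k : Fin 1) :
    boundary₁ P (cell 1 i) k =
      groupRingLift P.gen (MonoidAlgebra.of ℂ _ (FreeGroup.of i) - 1) := by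
  rw [boundary₁_cell, map_sub, groupRingLift_of, FreeGroup.lift_apply_of, map_one, Pi.sub_apply,
    cell_apply, cell_apply, if_pos (Subsingleton.elim _ _), if_pos (Subsingleton.elim _ _), one_mul,
    map_one]

theorem boundary₂_cell_one_apply (s : Fin n) (i : Fin (n + 1)) :
    boundary₂ P (cell 1 s) i = groupRingLift P.gen (foxDeriv i (FreeGroup.mk (P.rel s))) := by
  rw [boundary₂_cell, map_one, one_smul, liftedPath_apply, map_one, one_mul]
  rfl

/-- Telescoping along the path; this is the fundamental formula of Fox calculus. -/
theorem boundary₁_liftedPath (g : Γ) (w : List (Fin (n + 1) × Bool)) :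
    boundary₁ P (liftedPath P.gen g w) =
      cell (g * FreeGroup.lift P.gen (FreeGroup.mk w)) 0 - cell g 0 := by
  induction w generalizing g with
  | nil => simp [liftedPath, ← FreeGroup.one_eq_mk]
  | cons a w ih =>
    obtain ⟨j, b⟩ := a
    have h : FreeGroup.mk ((j, b) :: w) = FreeGroup.mk [(j, b)] * FreeGroup.mk w := rfl
    cases b
    · have h' : FreeGroup.mk [(j, false)] = (FreeGroup.of j)⁻¹ := rfl
      rw [liftedPath, map_add, ih, map_neg, boundary₁_cell, h, h', map_mul, map_inv,
        FreeGroup.lift_apply_of, inv_mul_cancel_right, mul_assoc]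
      abel
    · have h' : FreeGroup.mk [(j, true)] = FreeGroup.of j := rfl
      rw [liftedPath, map_add, ih, boundary₁_cell, h, h', map_mul, FreeGroup.lift_apply_of,
        mul_assoc]
      abel

theorem lift_rel (s : Fin n) : FreeGroup.lift P.gen (FreeGroup.mk (P.rel s)) = 1 := by
  rw [← MonoidHom.mem_ker, P.ker_lift]
  exact Subgroup.subset_normalClosure ⟨s, rfl⟩

/-- A relator is trivial in `Γ`, so its lift is a closed path. -/
theorem boundary₁_comp_boundary₂ : boundary₁ P ∘ₗ boundary₂ P = 0 := by
  refine LinearMap.pi_ext' fun s => LinearMap.ext_ring ?_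
  have h : LinearMap.single (MonoidAlgebra ℂ Γ) (fun _ => MonoidAlgebra ℂ Γ) s 1 = cell 1 s := by
    rw [cell, map_one (MonoidAlgebra.of ℂ Γ)]
    rfl
  rw [LinearMap.comp_apply, h, LinearMap.comp_apply, boundary₂_cell, map_one, one_smul,
    boundary₁_liftedPath, lift_rel, mul_one, sub_self, LinearMap.zero_comp, LinearMap.zero_apply]

/-- The relator makes consecutive generators conjugate, and conjugation is invisible in a
commutative group. -/
theorem hom_gen_succ {H : Type*} [CommGroup H] (ε : Γ →* H) (s : Fin n) :
    ε (P.gen s.succ) = ε (P.gen s.castSucc) := by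
  have h := congrArg ε (lift_rel P s)
  rw [WirtingerPresentation.rel, crossingWord, FreeGroup.lift_mk, map_one] at h
  cases hs : P.sign s <;> simp [hs] at h
  · rw [mul_left_comm, inv_mul_cancel_left, mul_inv_eq_one] at h
    exact h.symm
  · rw [mul_left_comm, mul_inv_cancel_left, mul_inv_eq_one] at h
    exact h.symm

theorem hom_gen_eq {H : Type*} [CommGroup H] (ε : Γ →* H) (i : Fin (n + 1)) :
    ε (P.gen i) = ε (P.gen 0) := by
  induction i using Fin.induction with
  | zero => rfl
  | succ s ih => rw [hom_gen_succ, ih]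

theorem hom_gen_ne_one {H : Type*} [CommGroup H] [Nontrivial H] (ε : Γ →* H)
    (hε : Function.Surjective ε) (i : Fin (n + 1)) : ε (P.gen i) ≠ 1 := by
  intro hi
  have h (j) : ε (P.gen j) = 1 := by rw [hom_gen_eq, ← hom_gen_eq P ε i, hi]
  have h' : ε.comp (FreeGroup.lift P.gen) = 1 := by
    ext j
    simp [h]
  obtain ⟨z, hz⟩ := exists_ne (1 : H)
  obtain ⟨w, hw⟩ := (hε.comp P.surjective_lift) z
  exact hz (hw.symm.trans (DFunLike.congr_fun h' w))

end Words

/-! ### The matrices `t^ε(γ) ρ(γ)` and their determinants. -/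

section Monodromy

variable {Γ : Type*} [Group Γ] {n : ℕ} (P : WirtingerPresentation Γ n)
  (ε : Γ →* Multiplicative ℤ)
  {V : Type*} [NormedAddCommGroup V] [InnerProductSpace ℂ V] (ρ : Γ →* (V ≃ₗᵢ[ℂ] V))
  {m : ℕ} (v : OrthonormalBasis (Fin m) ℂ V)

/-- The extension of `ρ ⊗ ε` to the group ring. -/
def groupRingRep : MonoidAlgebra ℂ Γ →ₐ[ℂ] Matrix (Fin m) (Fin m) ℂ[T;T⁻¹] :=
  MonoidAlgebra.lift ℂ _ _ (matrixRep ε ρ v)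

@[simp]
theorem groupRingRep_of (g : Γ) :
    groupRingRep ε ρ v (MonoidAlgebra.of ℂ Γ g) = matrixRep ε ρ v g :=
  MonoidAlgebra.lift_of _ _

/-- `Φ` factors through `ℂ[Γ]`, where the coefficients of the boundary maps live. -/
theorem Phi_eq (a : MonoidAlgebra ℂ (FreeGroup (Fin (n + 1)))) :
    Phi P ε ρ v a = groupRingRep ε ρ v (groupRingLift P.gen a) := by
  suffices h : Phi P ε ρ v = (groupRingRep ε ρ v).comp (groupRingLift P.gen) from
    DFunLike.congr_fun h a
  apply MonoidAlgebra.algHom_ext' _ (Subsingleton.elim _ _)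
  refine MonoidHom.ext fun (w : FreeGroup (Fin (n + 1))) => ?_
  change Phi P ε ρ v (MonoidAlgebra.of ℂ _ _) =
    groupRingRep ε ρ v (groupRingLift P.gen (MonoidAlgebra.of ℂ _ _))
  rw [groupRingLift_of, groupRingRep_of, Phi, MonoidAlgebra.lift_of]
  rfl

theorem genMatrix_eq (j : Fin (n + 1)) : genMatrix P ε ρ v j = matrixRep ε ρ v (P.gen j) - 1 := by
  rw [genMatrix, map_sub, map_one, Phi_eq, groupRingLift_of, groupRingRep_of,
    FreeGroup.lift_apply_of]

/-- A unitary map has only eigenvalues of modulus one, so specialising `t` off the unit circle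
excludes the eigenvalue `1`. -/
theorem det_matrixRep_sub_one_ne_zero (g : Γ) (hg : ε g ≠ 1) :
    (matrixRep ε ρ v g - 1).det ≠ 0 := by
  intro h
  -- Any value with `|t| ≠ 0, 1` would serve.
  let x : ℂˣ := Units.mk0 2 two_ne_zero
  have h' := congrArg (LaurentPolynomial.eval₂ (RingHom.id ℂ) x) h
  rw [RingHom.map_det, map_zero, ← Matrix.exists_mulVec_eq_zero_iff] at h'
  obtain ⟨w, hw, hw'⟩ := h'
  have hmat : (LaurentPolynomial.eval₂ (RingHom.id ℂ) x).mapMatrix (matrixRep ε ρ v g - 1) =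
      ((2 : ℂ) ^ (Multiplicative.toAdd (ε g))) •
        (LinearMap.toMatrix v.toBasis v.toBasis (repEnd ρ g)) - 1 := by
    rw [map_sub, map_one]
    congr 1
    ext a b
    simp [matrixRep, x]
    ring
  let u : V := v.toBasis.equivFun.symm w
  have hu : v.toBasis.repr u = Finsupp.equivFunOnFinite.symm w := by
    ext i
    simp [u]
  rw [hmat, Matrix.sub_mulVec, Matrix.one_mulVec, Matrix.smul_mulVec, sub_eq_zero] at hw'
  have hw2 : ((2 : ℂ) ^ (Multiplicative.toAdd (ε g))) • ρ g u = u := by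
    apply v.toBasis.equivFun.injective
    have h1 := LinearMap.toMatrix_mulVec_repr v.toBasis v.toBasis (repEnd ρ g) u
    have h2 : ⇑(v.toBasis.repr u) = w := by rw [hu]; rfl
    rw [h2] at h1
    rw [map_smul]
    change _ • ⇑(v.toBasis.repr (repEnd ρ g u)) = ⇑(v.toBasis.repr u)
    rw [← h1, h2, hw']
  have hu0 : u ≠ 0 := by
    exact (v.toBasis.equivFun.symm.map_ne_zero_iff).2 hw
  -- Since `ρ g` preserves norms, `2 ^ ε(g) = 1`, so the exponent is zero.
  have hnorm := congrArg norm hw2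
  rw [norm_smul, LinearIsometryEquiv.norm_map, norm_zpow, mul_eq_right₀ (norm_ne_zero_iff.2 hu0),
    Complex.norm_ofNat, zpow_eq_one_iff_right₀ zero_le_two (by norm_num)] at hnorm
  exact hg (toAdd_eq_zero.1 hnorm)

theorem det_genMatrix_ne_zero (hε : Function.Surjective ε) (j : Fin (n + 1)) :
    (genMatrix P ε ρ v j).det ≠ 0 := by
  rw [genMatrix_eq]
  exact det_matrixRep_sub_one_ne_zero ε ρ v _ (hom_gen_ne_one P ε hε j)

/-- The Laurent monomials `z t ^ l` with `|z| = 1`. -/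
def unitaryMonomials : Submonoid ℂ[T;T⁻¹] where
  carrier := {p | ∃ (z : ℂ) (l : ℤ), ‖z‖ = 1 ∧ p = LaurentPolynomial.C z * LaurentPolynomial.T l}
  one_mem' := ⟨1, 0, by simp, by simp⟩
  mul_mem' := by
    rintro _ _ ⟨z, l, hz, rfl⟩ ⟨z', l', hz', rfl⟩
    refine ⟨z * z', l + l', by rw [norm_mul, hz, hz', one_mul], ?_⟩
    rw [LaurentPolynomial.T_add, map_mul]
    ring

theorem det_matrixRep_mem (g : Γ) : (matrixRep ε ρ v g).det ∈ unitaryMonomials := by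
  refine ⟨(LinearMap.toMatrix v.toBasis v.toBasis (repEnd ρ g)).det,
    m * Multiplicative.toAdd (ε g), ?_, ?_⟩
  · exact CStarRing.norm_of_mem_unitary <|
      Matrix.det_of_mem_unitary ((ρ g).toMatrix_mem_unitaryGroup v v)
  · change ((LaurentPolynomial.T (Multiplicative.toAdd (ε g)) : ℂ[T;T⁻¹]) •
      (LinearMap.toMatrix v.toBasis v.toBasis (repEnd ρ g)).map LaurentPolynomial.C).det = _
    rw [Matrix.det_smul, Fintype.card_fin, LaurentPolynomial.T_pow, mul_comm]
    congr 1
    exact (RingHom.map_det LaurentPolynomial.C _).symm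

end Monodromy

/-! ### Cochains as a free `Λ`-module, and the matrices of the coboundaries. -/

section CochainCoordinates

variable {Γ : Type*} [Group Γ] (ε : Γ →* Multiplicative ℤ)
  {V : Type*} [NormedAddCommGroup V] [InnerProductSpace ℂ V] (ρ : Γ →* (V ≃ₗᵢ[ℂ] V))

/-- The action of the group ring on `Λ ⊗ V`. -/
def laurentAct : MonoidAlgebra ℂ Γ →ₐ[ℂ] Module.End ℂ[T;T⁻¹] (ℂ[T;T⁻¹] ⊗[ℂ] V) :=
  MonoidAlgebra.lift ℂ _ _ (laurentRep ε ρ)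

@[simp]
theorem laurentAct_of (g : Γ) : laurentAct ε ρ (MonoidAlgebra.of ℂ Γ g) = laurentRep ε ρ g :=
  MonoidAlgebra.lift_of _ _

variable {ι : Type*}

/-- The right multiplication `φ ↦ φ * a` of cochains by an element of the group ring. -/
def cochainMul (φ : Cochains Γ ι) : MonoidAlgebra ℂ Γ →ₗ[ℂ] Cochains Γ ι where
  toFun a :=
    { toFun := fun c => φ c * a
      map_add' := fun c d => by rw [map_add, add_mul]
      map_smul' := fun b c => by
        rw [map_smul, RingHom.id_apply, smul_eq_mul, smul_eq_mul, mul_assoc] }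
  map_add' a b := LinearMap.ext fun c => mul_add _ _ _
  map_smul' z a := LinearMap.ext fun c => mul_smul_comm _ _ _

/-- The defining relations move group elements across the tensor sign; linearity extends this to the
group ring. -/
theorem mk_laurentAct_tmul (a : MonoidAlgebra ℂ Γ) (w : ℂ[T;T⁻¹] ⊗[ℂ] V) (φ : Cochains Γ ι) :
    (Submodule.Quotient.mk (laurentAct ε ρ a w ⊗ₜ φ) : CoverCochains ε ρ ι) =
      Submodule.Quotient.mk (w ⊗ₜ cochainMul φ a) := by
  induction a using MonoidAlgebra.induction_on with
  | of g =>
    rw [laurentAct_of, Submodule.Quotient.eq]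
    refine Submodule.subset_span ⟨g, w, cochainMul φ (MonoidAlgebra.of ℂ Γ g), ?_⟩
    congr 2
    ext1 c
    change _ = φ c * MonoidAlgebra.of ℂ Γ g * MonoidAlgebra.of ℂ Γ g⁻¹
    rw [mul_assoc, ← map_mul, mul_inv_cancel, map_one, mul_one]
  | add a b ha hb =>
    rw [map_add, LinearMap.add_apply, TensorProduct.add_tmul, Submodule.Quotient.mk_add, ha, hb,
      map_add, TensorProduct.tmul_add, Submodule.Quotient.mk_add]
  | smul z a ha =>
    rw [map_smul, LinearMap.smul_apply, ← TensorProduct.smul_tmul', Submodule.Quotient.mk_smul, ha,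
      map_smul, TensorProduct.tmul_smul, Submodule.Quotient.mk_smul]

variable [DecidableEq ι] (g : ι → Γ)

/-- The coordinates of a cochain with respect to the dual base of the lifts `g α • e_α`. -/
def cochainCoords : CoverCochains ε ρ ι →ₗ[ℂ[T;T⁻¹]] (ι → ℂ[T;T⁻¹] ⊗[ℂ] V) :=
  Submodule.liftQ _
    (TensorProduct.AlgebraTensorModule.lift
      { toFun := fun w =>
          { toFun := fun φ α => laurentAct ε ρ (φ (cell (g α) α)) w
            map_add' := fun φ ψ => by
              funext α
              rw [LinearMap.add_apply, map_add]
              rfl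
            map_smul' := fun z φ => by
              funext α
              rw [LinearMap.smul_apply, map_smul]
              rfl }
        map_add' := fun w w' => by
          refine LinearMap.ext fun φ => funext fun α => ?_
          exact map_add (laurentAct ε ρ (φ (cell (g α) α))) w w'
        map_smul' := fun p w => by
          refine LinearMap.ext fun φ => funext fun α => ?_
          exact map_smul (laurentAct ε ρ (φ (cell (g α) α))) p w })
    (Submodule.span_le.2 <| by
      rintro _ ⟨γ, w, φ, rfl⟩
      rw [SetLike.mem_coe, LinearMap.mem_ker, map_sub, sub_eq_zero]
      funext α
      change laurentAct ε ρ (φ (cell (g α) α) * MonoidAlgebra.of ℂ Γ γ⁻¹) (laurentRep ε ρ γ w) =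
        laurentAct ε ρ (φ (cell (g α) α)) w
      rw [← laurentAct_of, ← Module.End.mul_apply, ← map_mul, mul_assoc, ← map_mul, inv_mul_cancel,
        map_one, mul_one])

theorem cochainCoords_mk (w : ℂ[T;T⁻¹] ⊗[ℂ] V) (φ : Cochains Γ ι) (α : ι) :
    cochainCoords ε ρ g (Submodule.Quotient.mk (w ⊗ₜ φ)) α =
      laurentAct ε ρ (φ (cell (g α) α)) w :=
  rfl

/-- The cochain `∑ c^α ⊗ w_α`. -/
def cochainOfCoords [Fintype ι] : (ι → ℂ[T;T⁻¹] ⊗[ℂ] V) →ₗ[ℂ[T;T⁻¹]] CoverCochains ε ρ ι where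
  toFun w := ∑ α, Submodule.Quotient.mk (w α ⊗ₜ dualCell g α)
  map_add' w w' := by
    simp only [Pi.add_apply, TensorProduct.add_tmul, Submodule.Quotient.mk_add,
      Finset.sum_add_distrib]
  map_smul' p w := by
    simp only [Pi.smul_apply, ← TensorProduct.smul_tmul', Submodule.Quotient.mk_smul,
      Finset.smul_sum, RingHom.id_apply]

theorem sum_cochainMul_dualCell [Fintype ι] (φ : Cochains Γ ι) :
    ∑ α, cochainMul (dualCell g α) (φ (cell (g α) α)) = φ := by
  refine LinearMap.ext fun c => ?_
  have h (α : ι) : (c α * MonoidAlgebra.of ℂ Γ (g α)⁻¹) • cell (g α) α =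
      Pi.single (M := fun _ => MonoidAlgebra ℂ Γ) α (c α) := by
    rw [cell, ← Pi.single_smul, smul_eq_mul, mul_assoc, ← map_mul, inv_mul_cancel, map_one, mul_one]
  rw [LinearMap.sum_apply]
  change ∑ α, c α * MonoidAlgebra.of ℂ Γ (g α)⁻¹ * φ (cell (g α) α) = φ c
  simp only [← smul_eq_mul, ← map_smul]
  simp only [smul_eq_mul, h]
  rw [← map_sum, Finset.univ_sum_single]

/-- `C^i(X_∞, ρ)` is the direct sum of copies of `Λ ⊗ V`, one for each cell. -/
def cochainEquiv [Fintype ι] : CoverCochains ε ρ ι ≃ₗ[ℂ[T;T⁻¹]] (ι → ℂ[T;T⁻¹] ⊗[ℂ] V) :=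
  LinearEquiv.ofLinearMap (cochainCoords ε ρ g) (cochainOfCoords ε ρ g)
    (LinearMap.ext fun w => by
      funext β
      change cochainCoords ε ρ g (∑ α, Submodule.Quotient.mk (w α ⊗ₜ dualCell g α)) β = w β
      rw [map_sum, Finset.sum_apply]
      simp only [cochainCoords_mk, dualCell_cell]
      rw [Finset.sum_eq_single β]
      · simp
      · intro α _ hα
        simp [hα]
      · simp)
    (by
      apply Submodule.linearMap_qext
      apply TensorProduct.AlgebraTensorModule.ext
      intro w φ
      change ∑ α, (Submodule.Quotient.mk (laurentAct ε ρ (φ (cell (g α) α)) w ⊗ₜ dualCell g α) :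
        CoverCochains ε ρ ι) = Submodule.Quotient.mk (w ⊗ₜ φ)
      simp only [mk_laurentAct_tmul]
      conv_rhs => rw [← sum_cochainMul_dualCell g φ, TensorProduct.tmul_sum]
      exact (map_sum (Submodule.mkQ _) _ _).symm)

theorem cochainEquiv_symm_single [Fintype ι] (α : ι) (w : ℂ[T;T⁻¹] ⊗[ℂ] V) :
    (cochainEquiv ε ρ g).symm (Pi.single α w) = Submodule.Quotient.mk (w ⊗ₜ dualCell g α) := by
  change ∑ β, (Submodule.Quotient.mk ((Pi.single α w : ι → ℂ[T;T⁻¹] ⊗[ℂ] V) β ⊗ₜ dualCell g β) :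
    CoverCochains ε ρ ι) = _
  rw [Finset.sum_eq_single α]
  · rw [Pi.single_eq_same]
  · intro β _ hβ
    rw [Pi.single_eq_of_ne hβ, TensorProduct.zero_tmul, Submodule.Quotient.mk_zero]
  · simp

variable {m : ℕ} (v : OrthonormalBasis (Fin m) ℂ V)

/-- The base `1 ⊗ v_j` of `Λ ⊗ V`. -/
def laurentBasis : Module.Basis (Fin m) ℂ[T;T⁻¹] (ℂ[T;T⁻¹] ⊗[ℂ] V) :=
  Algebra.TensorProduct.basis ℂ[T;T⁻¹] v.toBasis

theorem laurentBasis_apply (j : Fin m) : laurentBasis v j = 1 ⊗ₜ v j := by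
  simp [laurentBasis]

/-- The base `c^α ⊗ v_j` of `C^i(X_∞, ρ)`. -/
def cochainBasis [Fintype ι] : Module.Basis (ι × Fin m) ℂ[T;T⁻¹] (CoverCochains ε ρ ι) :=
  ((Pi.basis fun _ : ι => laurentBasis v).reindex (Equiv.sigmaEquivProd ι (Fin m))).map
    (cochainEquiv ε ρ g).symm

theorem cochainBasis_apply [Fintype ι] (a : ι × Fin m) :
    cochainBasis ε ρ g v a =
      Submodule.Quotient.mk (((1 : ℂ[T;T⁻¹]) ⊗ₜ[ℂ] v a.2) ⊗ₜ[ℂ] dualCell g a.1) := by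
  simp [cochainBasis, cochainEquiv_symm_single, laurentBasis_apply]

theorem cochainBasis_repr [Fintype ι] (c : CoverCochains ε ρ ι) (a : ι × Fin m) :
    (cochainBasis ε ρ g v).repr c a = (laurentBasis v).repr (cochainCoords ε ρ g c a.1) a.2 := by
  simp [cochainBasis]
  rfl

/-- The preferred base as a base of `C^i(X_∞, ρ) ⊗ ℂ(t)`. -/
def preferredBasis [Fintype ι] : Module.Basis (ι × Fin m) Ct (RationalCochains ε ρ ι) :=
  Algebra.TensorProduct.basis Ct (cochainBasis ε ρ g v)

theorem coe_preferredBasis [Fintype ι] :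
    ⇑(preferredBasis ε ρ g v) = preferred ε ρ g v := by
  funext a
  rw [preferredBasis, Algebra.TensorProduct.basis_apply, cochainBasis_apply]
  rfl

theorem toMatrix_laurentAct (a : MonoidAlgebra ℂ Γ) :
    LinearMap.toMatrix (laurentBasis v) (laurentBasis v) (laurentAct ε ρ a) =
      groupRingRep ε ρ v a := by
  induction a using MonoidAlgebra.induction_on with
  | of g =>
    rw [laurentAct_of, groupRingRep_of]
    change LinearMap.toMatrix (laurentBasis v) (laurentBasis v)
      ((LaurentPolynomial.T (Multiplicative.toAdd (ε g)) : ℂ[T;T⁻¹]) •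
        LinearMap.baseChange ℂ[T;T⁻¹] (repEnd ρ g)) =
      (LaurentPolynomial.T (Multiplicative.toAdd (ε g)) : ℂ[T;T⁻¹]) •
        (LinearMap.toMatrix v.toBasis v.toBasis (repEnd ρ g)).map LaurentPolynomial.C
    rw [map_smul]
    congr 1
    exact LinearMap.toMatrix_baseChange ..
  | add a b ha hb => rw [map_add, map_add, map_add, ha, hb]
  | smul z a ha =>
    rw [map_smul (laurentAct ε ρ), map_smul (groupRingRep ε ρ v), ← ha]
    exact LinearMap.map_smul_of_tower
      (LinearMap.toMatrix (laurentBasis v) (laurentBasis v)).toLinearMap z (laurentAct ε ρ a)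

variable {κ : Type*} [DecidableEq κ] [Fintype ι] [Fintype κ]
  (d : Chains Γ κ →ₗ[MonoidAlgebra ℂ Γ] Chains Γ ι) (h : κ → Γ)

/-- The dual cochain of the lift `g_a e_a` takes the value `h_s d(e_s)_a g_a⁻¹` on the boundary of
`h_s e_s`. Changing lifts therefore multiplies blocks by monodromy matrices on both sides. -/
theorem toMatrix_coverComap (s : κ × Fin m) (a : ι × Fin m) :
    LinearMap.toMatrix (cochainBasis ε ρ g v) (cochainBasis ε ρ h v) (coverComap ε ρ d) s a =
      (matrixRep ε ρ v (h s.1) * groupRingRep ε ρ v (d (cell 1 s.1) a.1) *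
        matrixRep ε ρ v (g a.1)⁻¹) s.2 a.2 := by
  have hd : d (cell (h s.1) s.1) a.1 = MonoidAlgebra.of ℂ Γ (h s.1) * d (cell 1 s.1) a.1 := by
    have hc : cell (h s.1) s.1 = MonoidAlgebra.of ℂ Γ (h s.1) • cell 1 s.1 := by
      rw [cell, cell, ← Pi.single_smul, map_one, smul_eq_mul, mul_one]
    rw [hc, map_smul]
    rfl
  rw [LinearMap.toMatrix_apply, cochainBasis_apply, cochainBasis_repr]
  change (laurentBasis v).repr (laurentAct ε ρ
    (d (cell (h s.1) s.1) a.1 * MonoidAlgebra.of ℂ Γ (g a.1)⁻¹) (1 ⊗ₜ[ℂ] v a.2)) s.2 = _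
  rw [hd, ← laurentBasis_apply, ← LinearMap.toMatrix_apply, toMatrix_laurentAct, map_mul, map_mul,
    groupRingRep_of, groupRingRep_of]

theorem toMatrix_rationalComap :
    LinearMap.toMatrix (preferredBasis ε ρ g v) (preferredBasis ε ρ h v) (rationalComap ε ρ d) =
      (LinearMap.toMatrix (cochainBasis ε ρ g v) (cochainBasis ε ρ h v) (coverComap ε ρ d)).map
        (algebraMap ℂ[T;T⁻¹] Ct) := by
  rw [rationalComap, preferredBasis, preferredBasis]
  exact LinearMap.toMatrix_baseChange Ct (coverComap ε ρ d) (cochainBasis ε ρ g v)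
    (cochainBasis ε ρ h v)

end CochainCoordinates

/-! ### The coboundary squares to zero. -/

section Coboundary

variable {Γ : Type*} [Group Γ] (ε : Γ →* Multiplicative ℤ)
  {V : Type*} [NormedAddCommGroup V] [InnerProductSpace ℂ V] (ρ : Γ →* (V ≃ₗᵢ[ℂ] V))

theorem rationalComap_comp_eq_zero {ι κ μ : Type*}
    (d : Chains Γ ι →ₗ[MonoidAlgebra ℂ Γ] Chains Γ κ)
    (d' : Chains Γ κ →ₗ[MonoidAlgebra ℂ Γ] Chains Γ μ) (hd : d' ∘ₗ d = 0) :
    rationalComap ε ρ d ∘ₗ rationalComap ε ρ d' = 0 := by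
  have h : coverComap ε ρ d ∘ₗ coverComap ε ρ d' = 0 := by
    apply Submodule.linearMap_qext
    apply TensorProduct.AlgebraTensorModule.ext
    intro w φ
    change (Submodule.Quotient.mk (w ⊗ₜ (φ ∘ₗ d' ∘ₗ d)) : CoverCochains ε ρ ι) = 0
    rw [hd, LinearMap.comp_zero, TensorProduct.tmul_zero, Submodule.Quotient.mk_zero]
  rw [rationalComap, rationalComap, ← LinearMap.baseChange_comp, h, LinearMap.baseChange_zero]

end Coboundary

/-! ### Conjugate transposes of Laurent matrices, with `t` kept fixed. -/

section ConjugateTranspose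

/-- The conjugation of the coefficients of a Laurent polynomial. -/
def laurentConj : ℂ[T;T⁻¹] →+* ℂ[T;T⁻¹] :=
  AddMonoidAlgebra.mapRingHom ℤ (starRingEnd ℂ)

theorem laurentConj_C (z : ℂ) :
    laurentConj (LaurentPolynomial.C z) = LaurentPolynomial.C (starRingEnd ℂ z) :=
  AddMonoidAlgebra.map_single ..

theorem laurentConj_T (k : ℤ) :
    laurentConj (LaurentPolynomial.T k) = LaurentPolynomial.T k :=
  (AddMonoidAlgebra.map_single ..).trans (congrArg _ (map_one (starRingEnd ℂ)))

theorem laurentConj_laurentConj (p : ℂ[T;T⁻¹]) : laurentConj (laurentConj p) = p := by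
  ext k
  simp [laurentConj]

variable {ι κ μ : Type*}

/-- The transposed matrix with conjugated coefficients. -/
def conjT (A : Matrix ι κ ℂ[T;T⁻¹]) : Matrix κ ι ℂ[T;T⁻¹] :=
  (A.map laurentConj).transpose

theorem conjT_apply (A : Matrix ι κ ℂ[T;T⁻¹]) (i : κ) (j : ι) :
    conjT A i j = laurentConj (A j i) :=
  rfl

theorem conjT_mul [Fintype κ] (A : Matrix ι κ ℂ[T;T⁻¹]) (B : Matrix κ μ ℂ[T;T⁻¹]) :
    conjT (A * B) = conjT B * conjT A := by
  rw [conjT, Matrix.map_mul, Matrix.transpose_mul]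
  rfl

theorem conjT_add (A B : Matrix ι κ ℂ[T;T⁻¹]) : conjT (A + B) = conjT A + conjT B := by
  ext i j
  simp [conjT_apply]

theorem conjT_neg (A : Matrix ι κ ℂ[T;T⁻¹]) : conjT (-A) = -conjT A := by
  ext i j
  simp [conjT_apply]

theorem conjT_one [DecidableEq ι] : conjT (1 : Matrix ι ι ℂ[T;T⁻¹]) = 1 := by
  rw [conjT, Matrix.map_one _ (map_zero _) (map_one _), Matrix.transpose_one]

theorem det_conjT [Fintype ι] [DecidableEq ι] (A : Matrix ι ι ℂ[T;T⁻¹]) :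
    (conjT A).det = laurentConj A.det := by
  rw [conjT, Matrix.det_transpose, RingHom.map_det]
  rfl

theorem det_conjT_ne_zero [Fintype ι] [DecidableEq ι] {A : Matrix ι ι ℂ[T;T⁻¹]} (hA : A.det ≠ 0) :
    (conjT A).det ≠ 0 := by
  intro h
  rw [det_conjT] at h
  apply hA
  rw [← laurentConj_laurentConj A.det, h, map_zero]

end ConjugateTranspose

/-! ### Chains as a free `Λ`-module, and the matrices of the boundaries. -/

section ChainCoordinates

variable {Γ : Type*} [Group Γ] (ε : Γ →* Multiplicative ℤ)
  {V : Type*} [NormedAddCommGroup V] [InnerProductSpace ℂ V] (ρ : Γ →* (V ≃ₗᵢ[ℂ] V))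
  {m : ℕ} (v : OrthonormalBasis (Fin m) ℂ V)

/-- The antihomomorphism of rings with `g ↦ t ^ ε(g) ρ(g)⁻¹`. -/
def dualRep : MonoidAlgebra ℂ Γ →ₐ[ℂ] (Matrix (Fin m) (Fin m) ℂ[T;T⁻¹])ᵐᵒᵖ :=
  MonoidAlgebra.lift ℂ _ _
    { toFun := fun g => MulOpposite.op (conjT (matrixRep ε ρ v g))
      map_one' := by rw [map_one, conjT_one, MulOpposite.op_one]
      map_mul' := fun g h => by rw [map_mul, conjT_mul, MulOpposite.op_mul] }

/-- The matrices of the antihomomorphism `dualRep`. -/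
def dualMatrix : MonoidAlgebra ℂ Γ →ₗ[ℂ] Matrix (Fin m) (Fin m) ℂ[T;T⁻¹] :=
  (MulOpposite.opLinearEquiv ℂ).symm.toLinearMap ∘ₗ (dualRep ε ρ v).toLinearMap

theorem dualMatrix_of (g : Γ) :
    dualMatrix ε ρ v (MonoidAlgebra.of ℂ Γ g) = conjT (matrixRep ε ρ v g) :=
  congrArg MulOpposite.unop (MonoidAlgebra.lift_of _ _)

theorem dualMatrix_mul (a b : MonoidAlgebra ℂ Γ) :
    dualMatrix ε ρ v (a * b) = dualMatrix ε ρ v b * dualMatrix ε ρ v a :=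
  congrArg MulOpposite.unop (map_mul (dualRep ε ρ v) a b)

/-- `dualMatrix` is complex linear and `conjT` conjugate linear, so they can be compared only on
real combinations of group elements. Lifted paths have integer coefficients. -/
theorem dualMatrix_liftedPath {ι : Type*} [DecidableEq ι] (x : ι → Γ) (g : Γ)
    (w : List (ι × Bool)) (i : ι) :
    dualMatrix ε ρ v (liftedPath x g w i) = conjT (groupRingRep ε ρ v (liftedPath x g w i)) := by
  have h0 : dualMatrix ε ρ v 0 = conjT (groupRingRep ε ρ v 0) := by
    ext
    simp [conjT_apply]
  have hcell (γ : Γ) (k : ι) :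
      dualMatrix ε ρ v (cell γ k i) = conjT (groupRingRep ε ρ v (cell γ k i)) := by
    rw [cell_apply]
    split_ifs
    · rw [dualMatrix_of, groupRingRep_of]
    · exact h0
  induction w generalizing g with
  | nil => exact h0
  | cons a w ih =>
    obtain ⟨k, b⟩ := a
    cases b
    · rw [liftedPath, Pi.add_apply, map_add, map_add, conjT_add, ih, Pi.neg_apply, map_neg, map_neg,
        conjT_neg, hcell]
    · rw [liftedPath, Pi.add_apply, map_add, map_add, conjT_add, ih, hcell]

/-- The coordinates of a vector, as constant Laurent polynomials. -/
def constCoords : V →ₗ[ℂ] (Fin m → ℂ[T;T⁻¹]) where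
  toFun w b := LaurentPolynomial.C (v.repr w b)
  map_add' w w' := by
    funext b
    simp
  map_smul' z w := by
    funext b
    simp [LaurentPolynomial.smul_eq_C_mul]

theorem constCoords_basis (b : Fin m) : constCoords v (v b) = Pi.single b 1 := by
  funext c
  by_cases h : c = b
  · subst h
    simp [constCoords]
  · simp [constCoords, h]

/-- Unitarity turns the conjugate transpose into `ρ(g)⁻¹`, while the power of `t` survives. On `Ker
ε` that power is `1`, which makes the chain coordinates well defined. -/
theorem conjT_matrixRep_mulVec (g : Γ) (w : V) :
    (conjT (matrixRep ε ρ v g)).mulVec (constCoords v (ρ g w)) =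
      (LaurentPolynomial.T (Multiplicative.toAdd (ε g)) : ℂ[T;T⁻¹]) • constCoords v w := by
  set M := LinearMap.toMatrix v.toBasis v.toBasis (repEnd ρ g) with hM
  have h1 : conjT (matrixRep ε ρ v g) =
      (LaurentPolynomial.T (Multiplicative.toAdd (ε g)) : ℂ[T;T⁻¹]) •
        M.conjTranspose.map LaurentPolynomial.C := by
    ext i j
    simp [conjT_apply, matrixRep, laurentConj_C, laurentConj_T, ← hM]
  have h2 : constCoords v (ρ g w) =
      (M.map LaurentPolynomial.C).mulVec (constCoords v w) := by
    funext i
    have h := congrFun (LinearMap.toMatrix_mulVec_repr v.toBasis v.toBasis (repEnd ρ g) w) i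
    change LaurentPolynomial.C (v.toBasis.repr (repEnd ρ g w) i) = _
    rw [← h]
    simp only [Matrix.mulVec, dotProduct, map_sum, map_mul]
    rfl
  have h3 : M.conjTranspose * M = 1 :=
    (Matrix.mem_unitaryGroup_iff'.1 ((ρ g).toMatrix_mem_unitaryGroup v v))
  rw [h1, h2, Matrix.smul_mulVec, Matrix.mulVec_mulVec, ← Matrix.map_mul, h3,
    Matrix.map_one _ (map_zero _) (map_one _), Matrix.one_mulVec]

variable {ι κ : Type*}

/-- The coordinates of a chain with coefficients in `V_ρ`, which identify `C_i(X_∞, ρ)` with a free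
`Λ`-module. -/
def chainCoords : CoverChains ε ρ ι →ₗ[ℂ] (ι → Fin m → ℂ[T;T⁻¹]) :=
  Submodule.liftQ _
    (TensorProduct.lift (LinearMap.mk₂ ℂ
      (fun w (c : Chains Γ ι) α => (dualMatrix ε ρ v (c α)).mulVec (constCoords v w))
      (fun w w' c => by
        funext α
        simp [Matrix.mulVec_add])
      (fun z w c => by
        funext α
        simp [Matrix.mulVec_smul])
      (fun w c c' => by
        funext α
        simp [Matrix.add_mulVec])
      (fun z w c => by
        funext α
        simp [Matrix.smul_mulVec])))
    (Submodule.span_le.2 <| by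
      rintro _ ⟨γ, w, c, rfl⟩
      rw [SetLike.mem_coe, LinearMap.mem_ker, map_sub, sub_eq_zero]
      funext α
      change (dualMatrix ε ρ v (MonoidAlgebra.of ℂ Γ γ * c α)).mulVec (constCoords v (ρ γ w)) =
        (dualMatrix ε ρ v (c α)).mulVec (constCoords v w)
      have hγ : ε γ = 1 := γ.2
      rw [dualMatrix_mul, ← Matrix.mulVec_mulVec, dualMatrix_of, conjT_matrixRep_mulVec, hγ,
        toAdd_one, LaurentPolynomial.T_zero, one_smul])

theorem chainCoords_mk (w : V) (c : Chains Γ ι) (α : ι) :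
    chainCoords ε ρ v (Submodule.Quotient.mk (w ⊗ₜ c)) α =
      (dualMatrix ε ρ v (c α)).mulVec (constCoords v w) :=
  rfl

theorem mk_deck (g : Γ) (hg : ε g = 1) (w : V) (c : Chains Γ ι) :
    (Submodule.Quotient.mk (ρ g w ⊗ₜ deck Γ ι g c) : CoverChains ε ρ ι) =
      Submodule.Quotient.mk (w ⊗ₜ c) :=
  (Submodule.Quotient.eq _).2 (Submodule.subset_span ⟨⟨g, hg⟩, w, c, rfl⟩)

theorem deck_cell [DecidableEq ι] (g h : Γ) (α : ι) : deck Γ ι g (cell h α) = cell (g * h) α := by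
  change MonoidAlgebra.of ℂ Γ g • cell h α = _
  rw [cell, cell, ← Pi.single_smul, smul_eq_mul, ← map_mul]

/-- The chain with prescribed coordinates, for an element `h` of `Γ` with `ε(h) = 1`. -/
def chainOfCoords [DecidableEq ι] [Fintype ι] (h : Γ) :
    (ι → Fin m → ℂ[T;T⁻¹]) →ₗ[ℂ] CoverChains ε ρ ι :=
  ∑ α, ∑ b, (Finsupp.linearCombination ℂ fun k : ℤ =>
      (Submodule.Quotient.mk (ρ (h ^ k) (v b) ⊗ₜ cell (h ^ k) α) : CoverChains ε ρ ι)) ∘ₗ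
    (AddMonoidAlgebra.coeffLinearEquiv ℂ).toLinearMap ∘ₗ LinearMap.proj b ∘ₗ LinearMap.proj α

variable [DecidableEq ι]

theorem chainCoords_cell (g : Γ) (w : V) (α : ι) :
    chainCoords ε ρ v (Submodule.Quotient.mk (ρ g w ⊗ₜ cell g α)) =
      Pi.single α
        ((LaurentPolynomial.T (Multiplicative.toAdd (ε g)) : ℂ[T;T⁻¹]) • constCoords v w) := by
  funext β
  rw [chainCoords_mk, cell_apply]
  by_cases hβ : α = β
  · subst hβ
    rw [if_pos rfl, Pi.single_eq_same, dualMatrix_of, conjT_matrixRep_mulVec]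
  · rw [if_neg hβ, Pi.single_eq_of_ne (Ne.symm hβ), map_zero, Matrix.zero_mulVec]

variable [Fintype ι]

theorem chainOfCoords_single (h : Γ) (α : ι) (k : ℤ) (w : V) :
    chainOfCoords ε ρ v h (Pi.single α
      ((LaurentPolynomial.T k : ℂ[T;T⁻¹]) • constCoords v w)) =
      Submodule.Quotient.mk (ρ (h ^ k) w ⊗ₜ cell (h ^ k) α) := by
  have hcoef (b : Fin m) : AddMonoidAlgebra.coeffLinearEquiv ℂ
      ((LaurentPolynomial.T k : ℂ[T;T⁻¹]) * LaurentPolynomial.C (v.repr w b)) =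
      Finsupp.single k (v.repr w b) := by
    rw [mul_comm, ← LaurentPolynomial.single_eq_C_mul_T]
    rfl
  rw [chainOfCoords, LinearMap.sum_apply, Finset.sum_eq_single α]
  · rw [LinearMap.sum_apply]
    simp only [LinearMap.comp_apply, LinearMap.proj_apply, Pi.single_eq_same, Pi.smul_apply,
      smul_eq_mul]
    change ∑ b, Finsupp.linearCombination ℂ _ (AddMonoidAlgebra.coeffLinearEquiv ℂ
      ((LaurentPolynomial.T k : ℂ[T;T⁻¹]) * LaurentPolynomial.C (v.repr w b))) = _
    simp only [hcoef, Finsupp.linearCombination_single]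
    conv_rhs => rw [← v.sum_repr w, map_sum, TensorProduct.sum_tmul]
    refine Eq.trans ?_ (map_sum (Submodule.mkQ _) _ _).symm
    refine Finset.sum_congr rfl fun b _ => ?_
    rw [map_smul, ← TensorProduct.smul_tmul', map_smul]
    rfl
  · intro β _ hβ
    simp [Pi.single_eq_of_ne hβ]
  · simp

theorem chainOfCoords_chainCoords {h : Γ} (hh : ε h = Multiplicative.ofAdd 1)
    (c : CoverChains ε ρ ι) : chainOfCoords ε ρ v h (chainCoords ε ρ v c) = c := by
  suffices H : chainOfCoords ε ρ v h ∘ₗ chainCoords ε ρ v = LinearMap.id from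
    LinearMap.congr_fun H c
  apply Submodule.linearMap_qext
  apply TensorProduct.ext
  refine LinearMap.ext fun w => LinearMap.pi_ext' fun α => MonoidAlgebra.lhom_ext' fun g =>
    LinearMap.ext_ring ?_
  change chainOfCoords ε ρ v h (chainCoords ε ρ v (Submodule.Quotient.mk (w ⊗ₜ cell g α))) =
    Submodule.Quotient.mk (w ⊗ₜ cell g α)
  -- Brings the generator to the form `ρ(g) w' ⊗ g e_α`, whose coordinates are `t^ε(g) w'`.
  have hw : w = ρ g (ρ g⁻¹ w) := by
    change w = (ρ g * ρ g⁻¹) w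
    rw [← map_mul, mul_inv_cancel, map_one]
    rfl
  conv_lhs => rw [hw]
  rw [chainCoords_cell, chainOfCoords_single]
  set k := Multiplicative.toAdd (ε g) with hk
  -- The power `h ^ k` represents the coset of `g` modulo `Ker ε`, so the two chains differ by a
  -- translation in `Ker ε`.
  have hx : ε (h ^ k * g⁻¹) = 1 := by
    rw [map_mul, map_zpow, hh, map_inv, mul_inv_eq_one, ← ofAdd_zsmul, smul_eq_mul, mul_one, hk,
      ofAdd_toAdd]
  rw [← mk_deck ε ρ _ hx w, deck_cell, inv_mul_cancel_right, map_mul]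
  rfl

theorem chainCoords_chainOfCoords {h : Γ} (hh : ε h = Multiplicative.ofAdd 1)
    (u : ι → Fin m → ℂ[T;T⁻¹]) : chainCoords ε ρ v (chainOfCoords ε ρ v h u) = u := by
  suffices H : chainCoords ε ρ v ∘ₗ chainOfCoords ε ρ v h = LinearMap.id from
    LinearMap.congr_fun H u
  refine LinearMap.pi_ext' fun α => LinearMap.pi_ext' fun b => AddMonoidAlgebra.lhom_ext' fun k =>
    LinearMap.ext_ring ?_
  have hT : (Pi.single b (LaurentPolynomial.T k) : Fin m → ℂ[T;T⁻¹]) =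
      (LaurentPolynomial.T k : ℂ[T;T⁻¹]) • constCoords v (v b) := by
    rw [constCoords_basis, ← Pi.single_smul, smul_eq_mul, mul_one]
  change chainCoords ε ρ v (chainOfCoords ε ρ v h (Pi.single α
    (Pi.single b (LaurentPolynomial.T k)))) = Pi.single α (Pi.single b (LaurentPolynomial.T k))
  rw [hT, chainOfCoords_single, chainCoords_cell, map_zpow, hh, ← ofAdd_zsmul, toAdd_ofAdd,
    smul_eq_mul, mul_one]

/-- `C_i(X_∞, ρ)` is a free `Λ`-module. -/
def chainEquiv {h : Γ} (hh : ε h = Multiplicative.ofAdd 1) :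
    CoverChains ε ρ ι ≃ₗ[ℂ] (ι → Fin m → ℂ[T;T⁻¹]) :=
  LinearEquiv.ofLinearMap (chainCoords ε ρ v) (chainOfCoords ε ρ v h)
    (LinearMap.ext (chainCoords_chainOfCoords ε ρ v hh))
    (LinearMap.ext (chainOfCoords_chainCoords ε ρ v hh))

/-- The boundary map in coordinates. -/
def coordMap (d : Chains Γ ι →ₗ[MonoidAlgebra ℂ Γ] Chains Γ κ) :
    (ι → Fin m → ℂ[T;T⁻¹]) →ₗ[ℂ[T;T⁻¹]] (κ → Fin m → ℂ[T;T⁻¹]) where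
  toFun u k := ∑ s, (dualMatrix ε ρ v (d (cell 1 s) k)).mulVec (u s)
  map_add' u u' := by
    funext k
    simp only [Pi.add_apply, Matrix.mulVec_add, Finset.sum_add_distrib]
  map_smul' p u := by
    funext k
    simp only [Pi.smul_apply, Matrix.mulVec_smul, Finset.smul_sum, RingHom.id_apply]

theorem chainCoords_coverMap (d : Chains Γ ι →ₗ[MonoidAlgebra ℂ Γ] Chains Γ κ)
    (c : CoverChains ε ρ ι) :
    chainCoords ε ρ v (coverMap ε ρ d c) = coordMap ε ρ v d (chainCoords ε ρ v c) := by
  suffices H : chainCoords ε ρ v ∘ₗ coverMap ε ρ d =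
      (coordMap ε ρ v d).restrictScalars ℂ ∘ₗ chainCoords ε ρ v from LinearMap.congr_fun H c
  apply Submodule.linearMap_qext
  apply TensorProduct.ext
  refine LinearMap.ext fun w => LinearMap.ext fun c => funext fun k => ?_
  change (dualMatrix ε ρ v (d c k)).mulVec (constCoords v w) =
    ∑ s, (dualMatrix ε ρ v (d (cell 1 s) k)).mulVec
      ((dualMatrix ε ρ v (c s)).mulVec (constCoords v w))
  have hc : c = ∑ s, c s • cell (1 : Γ) s := by
    funext s
    rw [Finset.sum_apply]
    simp only [Pi.smul_apply, cell_apply, map_one, smul_eq_mul, mul_ite, mul_one, mul_zero,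
      Finset.sum_ite_eq', Finset.mem_univ, if_true]
  have hd : d c k = ∑ s, c s * d (cell 1 s) k := by
    conv_lhs => rw [hc]
    rw [map_sum, Finset.sum_apply]
    refine Finset.sum_congr rfl fun s _ => ?_
    rw [map_smul]
    rfl
  rw [hd, map_sum, Matrix.sum_mulVec]
  refine Finset.sum_congr rfl fun s _ => ?_
  rw [dualMatrix_mul, Matrix.mulVec_mulVec]

theorem not_finite_laurentPolynomial : ¬ Module.Finite ℂ ℂ[T;T⁻¹] := fun _ =>
  Polynomial.not_finite (R := ℂ) <|
    Module.Finite.of_injective (Polynomial.toLaurentAlg (R := ℂ)).toLinearMap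
      Polynomial.toLaurent_injective

/-- A nonzero kernel element would span a copy of `Λ` inside the kernel, by `Λ`-linearity and
torsion-freeness, and `Λ` has infinite dimension over `ℂ`. -/
theorem coordMap_injective {h : Γ} (hh : ε h = Multiplicative.ofAdd 1) [DecidableEq κ] [Fintype κ]
    (d : Chains Γ ι →ₗ[MonoidAlgebra ℂ Γ] Chains Γ κ)
    (hd : Module.Finite ℂ (LinearMap.ker (coverMap ε ρ d))) (u : ι → Fin m → ℂ[T;T⁻¹])
    (hu : coordMap ε ρ v d u = 0) : u = 0 := by
  by_contra hne
  let f : ℂ[T;T⁻¹] →ₗ[ℂ] CoverChains ε ρ ι := (chainEquiv ε ρ v hh).symm.toLinearMap ∘ₗ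
    (LinearMap.toSpanSingleton ℂ[T;T⁻¹] _ u).restrictScalars ℂ
  have hf (p) : f p ∈ LinearMap.ker (coverMap ε ρ d) := by
    rw [LinearMap.mem_ker]
    apply (chainEquiv ε ρ v hh).injective
    rw [map_zero]
    change chainCoords ε ρ v (coverMap ε ρ d (f p)) = 0
    rw [chainCoords_coverMap]
    change coordMap ε ρ v d (chainEquiv ε ρ v hh ((chainEquiv ε ρ v hh).symm (p • u))) = 0
    rw [LinearEquiv.apply_symm_apply, map_smul, hu, smul_zero]
  refine not_finite_laurentPolynomial (Module.Finite.of_injective (f.codRestrict _ hf) ?_)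
  intro p q hpq
  have h1 : f p = f q := congrArg Subtype.val hpq
  have h2 : p • u = q • u := (chainEquiv ε ρ v hh).symm.injective h1
  exact smul_left_injective _ hne h2

theorem coordMap_comp_eq_zero {μ : Type*} {h : Γ} (hh : ε h = Multiplicative.ofAdd 1)
    [DecidableEq κ] [Fintype κ]
    (d : Chains Γ ι →ₗ[MonoidAlgebra ℂ Γ] Chains Γ κ)
    (d' : Chains Γ κ →ₗ[MonoidAlgebra ℂ Γ] Chains Γ μ) (hd : d' ∘ₗ d = 0)
    (u : ι → Fin m → ℂ[T;T⁻¹]) : coordMap ε ρ v d' (coordMap ε ρ v d u) = 0 := by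
  rw [← chainCoords_chainOfCoords ε ρ v hh u, ← chainCoords_coverMap, ← chainCoords_coverMap]
  have h0 : coverMap ε ρ d' ∘ₗ coverMap ε ρ d = 0 := by
    apply Submodule.linearMap_qext
    apply TensorProduct.ext
    refine LinearMap.ext fun w => LinearMap.ext fun c => ?_
    change (Submodule.Quotient.mk (w ⊗ₜ (d' ∘ₗ d) c) : CoverChains ε ρ μ) = 0
    rw [hd, LinearMap.zero_apply, TensorProduct.tmul_zero, Submodule.Quotient.mk_zero]
  exact (congrArg _ (LinearMap.congr_fun h0 _)).trans (map_zero _)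

end ChainCoordinates

/-! ### Nonvanishing of the Alexander determinant. -/

section AlexanderDeterminant

variable {Γ : Type*} [Group Γ] {n : ℕ} (P : WirtingerPresentation Γ n)
  (ε : Γ →* Multiplicative ℤ)
  {V : Type*} [NormedAddCommGroup V] [InnerProductSpace ℂ V] (ρ : Γ →* (V ≃ₗᵢ[ℂ] V))
  {m : ℕ} (v : OrthonormalBasis (Fin m) ℂ V)

theorem dualMatrix_boundary₁ (j : Fin (n + 1)) (k : Fin 1) :
    dualMatrix ε ρ v (boundary₁ P (cell 1 j) k) = conjT (genMatrix P ε ρ v j) := by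
  rw [boundary₁_cell_one_apply, genMatrix_eq, map_sub, groupRingLift_of, FreeGroup.lift_apply_of,
    map_one, map_sub, dualMatrix_of, ← map_one (MonoidAlgebra.of ℂ Γ), dualMatrix_of, map_one,
    sub_eq_add_neg, sub_eq_add_neg, conjT_add, conjT_neg]

theorem dualMatrix_boundary₂ (s : Fin n) (i : Fin (n + 1)) :
    dualMatrix ε ρ v (boundary₂ P (cell 1 s) i) =
      conjT (Phi P ε ρ v (foxDeriv i (FreeGroup.mk (P.rel s)))) := by
  rw [Phi_eq, ← boundary₂_cell_one_apply, boundary₂_cell, map_one, one_smul, dualMatrix_liftedPath]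

theorem det_alexanderMatrix_ne_zero (hε : Function.Surjective ε) (hfin : FiniteHomology P ε ρ)
    (j : Fin (n + 1)) : (alexanderMatrix P ε ρ v j).det ≠ 0 := by
  obtain ⟨h, hh⟩ := hε (Multiplicative.ofAdd 1)
  intro hdet
  have hdet' : (conjT (alexanderMatrix P ε ρ v j)).det = 0 := by rw [det_conjT, hdet, map_zero]
  obtain ⟨w, hw, hw'⟩ := Matrix.exists_mulVec_eq_zero_iff.2 hdet'
  let u : Fin n → Fin m → ℂ[T;T⁻¹] := fun s a => w (s, a)
  -- The conjugate transpose of `A_j` computes the components of `∂₂ u` on all edges except `x_j`.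
  have h1 (i : Fin n) : coordMap ε ρ v (boundary₂ P) u (j.succAbove i) = 0 := by
    funext b
    have := congrFun hw' (i, b)
    change (∑ s, (dualMatrix ε ρ v (boundary₂ P (cell 1 s) (j.succAbove i))).mulVec (u s)) b = 0
    rw [Finset.sum_apply]
    refine Eq.trans ?_ this
    rw [Matrix.mulVec, dotProduct, Fintype.sum_prod_type]
    refine Finset.sum_congr rfl fun s _ => ?_
    rw [dualMatrix_boundary₂]
    rfl
  -- Only the edge `x_j` contributes to `∂₁ ∂₂ u = 0`, through the nonsingular conjugate transpose
  -- of `Φ(x_j - 1)`.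
  have h2 : coordMap ε ρ v (boundary₂ P) u j = 0 := by
    have h3 := congrFun (coordMap_comp_eq_zero ε ρ v hh _ _ (boundary₁_comp_boundary₂ P) u) 0
    change ∑ i, (dualMatrix ε ρ v (boundary₁ P (cell 1 i) 0)).mulVec
      (coordMap ε ρ v (boundary₂ P) u i) = 0 at h3
    rw [Fin.sum_univ_succAbove _ j] at h3
    simp only [h1, Matrix.mulVec_zero, Finset.sum_const_zero, add_zero,
      dualMatrix_boundary₁] at h3
    exact Matrix.eq_zero_of_mulVec_eq_zero
      (det_conjT_ne_zero (det_genMatrix_ne_zero P ε ρ v hε j)) h3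
  have h4 : coordMap ε ρ v (boundary₂ P) u = 0 := by
    funext i
    rcases Fin.eq_self_or_eq_succAbove j i with rfl | ⟨i, rfl⟩
    · exact h2
    · exact h1 i
  have h5 := coordMap_injective ε ρ v hh (boundary₂ P) hfin.2.2 u h4
  exact hw (funext fun a => congrFun (congrFun h5 a.1) a.2)

end AlexanderDeterminant

/-! ### The two minors in the preferred bases, and the torsion. -/

section PreferredDeterminants

variable {Γ : Type*} [Group Γ] {n : ℕ} (P : WirtingerPresentation Γ n)
  (ε : Γ →* Multiplicative ℤ)
  {V : Type*} [NormedAddCommGroup V] [InnerProductSpace ℂ V] (ρ : Γ →* (V ≃ₗᵢ[ℂ] V))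
  {m : ℕ} (v : OrthonormalBasis (Fin m) ℂ V)

theorem unitaryMonomials_exists_inv {p : ℂ[T;T⁻¹]} (hp : p ∈ unitaryMonomials) :
    ∃ q ∈ unitaryMonomials, p * q = 1 := by
  obtain ⟨z, l, hz, rfl⟩ := hp
  refine ⟨_, ⟨z⁻¹, -l, by rw [norm_inv, hz, inv_one], rfl⟩, ?_⟩
  have hz0 : z ≠ 0 := norm_ne_zero_iff.1 (hz ▸ one_ne_zero)
  rw [mul_mul_mul_comm, ← map_mul, ← LaurentPolynomial.T_add, mul_inv_cancel₀ hz0, map_one,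
    add_neg_cancel, LaurentPolynomial.T_zero, one_mul]

theorem intCast_units_mem_unitaryMonomials (s : ℤˣ) : ((s : ℤ) : ℂ[T;T⁻¹]) ∈ unitaryMonomials := by
  refine ⟨((s : ℤ) : ℂ), 0, ?_, by simp⟩
  rcases Int.units_eq_one_or s with rfl | rfl <;> simp

/-- The block diagonal matrix with the blocks `t ^ ε(h_i) ρ(h_i)`. -/
def diagRep {ι : Type*} [DecidableEq ι] (h : ι → Γ) :
    Matrix (ι × Fin m) (ι × Fin m) ℂ[T;T⁻¹] :=
  (Matrix.blockDiagonal fun i => matrixRep ε ρ v (h i)).submatrix (Equiv.prodComm _ _)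
    (Equiv.prodComm _ _)

theorem diagRep_apply {ι : Type*} [DecidableEq ι] (h : ι → Γ) (a b : ι × Fin m) :
    diagRep ε ρ v h a b = if a.1 = b.1 then matrixRep ε ρ v (h a.1) a.2 b.2 else 0 :=
  rfl

theorem det_diagRep_mem {ι : Type*} [DecidableEq ι] [Fintype ι] (h : ι → Γ) :
    (diagRep ε ρ v h).det ∈ unitaryMonomials := by
  rw [diagRep, Matrix.det_submatrix_equiv_self, Matrix.det_blockDiagonal]
  exact Submonoid.prod_mem _ fun i _ => det_matrixRep_mem ε ρ v (h i)

/-- The separation of the cells of the generator `x_j` from the other edges. -/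
def splitAt (j : Fin (n + 1)) : Fin (n + 1) × Fin m ≃ (Fin 1 × Fin m) ⊕ (Fin n × Fin m) where
  toFun a := j.insertNth (α := fun _ => (Fin 1 × Fin m) ⊕ (Fin n × Fin m)) (.inl (0, a.2))
    (fun i => .inr (i, a.2)) a.1
  invFun := Sum.elim (fun a => (j, a.2)) (fun a => (j.succAbove a.1, a.2))
  left_inv := by
    rintro ⟨i, a⟩
    rcases Fin.eq_self_or_eq_succAbove j i with rfl | ⟨i, rfl⟩ <;> simp
  right_inv := by
    rintro (⟨i, a⟩ | ⟨i, a⟩)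
    · simp [Subsingleton.elim i 0]
    · simp

variable (g₀ : Fin 1 → Γ) (g₁ : Fin (n + 1) → Γ) (g₂ : Fin n → Γ) (j : Fin (n + 1))

theorem det_generator_block : ∃ p ∈ unitaryMonomials,
    ((LinearMap.toMatrix (preferredBasis ε ρ g₀ v) (preferredBasis ε ρ g₁ v)
      (rationalComap ε ρ (boundary₁ P))).submatrix (fun i => (splitAt j).symm (.inl i)) id).det =
      algebraMap ℂ[T;T⁻¹] Ct (p * (genMatrix P ε ρ v j).det) := by
  refine ⟨(matrixRep ε ρ v (g₁ j)).det * (matrixRep ε ρ v (g₀ 0)⁻¹).det,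
    mul_mem (det_matrixRep_mem ..) (det_matrixRep_mem ..), ?_⟩
  rw [mul_right_comm, ← Matrix.det_mul, ← Matrix.det_mul,
    ← Matrix.det_submatrix_equiv_self (Equiv.uniqueProd (Fin m) (Fin 1)), RingHom.map_det,
    toMatrix_rationalComap]
  congr 1
  ext ⟨i, a⟩ ⟨k, b⟩
  change algebraMap ℂ[T;T⁻¹] Ct (LinearMap.toMatrix _ _ _ (j, a) (k, b)) =
    algebraMap ℂ[T;T⁻¹] Ct ((_ * _ * _ : Matrix (Fin m) (Fin m) ℂ[T;T⁻¹]) a b)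
  rw [toMatrix_coverComap, Subsingleton.elim k 0, boundary₁_cell_one_apply, ← Phi_eq]
  rfl

theorem det_relator_block : ∃ p ∈ unitaryMonomials,
    ((LinearMap.toMatrix (preferredBasis ε ρ g₁ v) (preferredBasis ε ρ g₂ v)
      (rationalComap ε ρ (boundary₂ P))).submatrix id (fun i => (splitAt j).symm (.inr i))).det =
      algebraMap ℂ[T;T⁻¹] Ct (p * (alexanderMatrix P ε ρ v j).det) := by
  refine ⟨(diagRep ε ρ v g₂).det * (diagRep ε ρ v fun i => (g₁ (j.succAbove i))⁻¹).det,
    mul_mem (det_diagRep_mem ..) (det_diagRep_mem ..), ?_⟩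
  rw [mul_right_comm, ← Matrix.det_mul, ← Matrix.det_mul, RingHom.map_det, toMatrix_rationalComap]
  congr 1
  ext ⟨s, a⟩ ⟨i, b⟩
  change algebraMap ℂ[T;T⁻¹] Ct (LinearMap.toMatrix _ _ _ (s, a) (j.succAbove i, b)) =
    algebraMap ℂ[T;T⁻¹] Ct ((_ * _ * _ : Matrix (Fin n × Fin m) (Fin n × Fin m) ℂ[T;T⁻¹]) _ _)
  rw [toMatrix_coverComap, boundary₂_cell_one_apply, ← Phi_eq]
  congr 1
  -- Multiplication by block diagonal matrices acts block by block, so the sums over cells collapse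
  -- to one term.
  simp only [Matrix.mul_apply, Fintype.sum_prod_type, diagRep_apply, ite_mul, mul_ite, zero_mul,
    mul_zero]
  rw [Finset.sum_comm]
  simp only [Finset.sum_ite_eq', Finset.mem_univ, if_true]
  refine Finset.sum_congr rfl fun c _ => ?_
  congr 1
  rw [Finset.sum_comm]
  simp only [Finset.sum_ite_eq, Finset.mem_univ, if_true]
  rfl

theorem exists_isMilnorReidemeisterTorsion (hX : (genMatrix P ε ρ v j).det ≠ 0)
    (hA : (alexanderMatrix P ε ρ v j).det ≠ 0) :
    (∃ τ : Ct, IsMilnorReidemeisterTorsion P ε ρ g₀ g₁ g₂ v τ) ∧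
    ∀ τ : Ct, IsMilnorReidemeisterTorsion P ε ρ g₀ g₁ g₂ v τ →
      ∃ p ∈ unitaryMonomials,
        τ = algebraMap ℂ[T;T⁻¹] Ct p * (twistedAlexander P ε ρ v j)⁻¹ := by
  obtain ⟨p, hp, hpX⟩ := det_generator_block P ε ρ v g₀ g₁ j
  obtain ⟨q, hq, hqA⟩ := det_relator_block P ε ρ v g₁ g₂ j
  obtain ⟨p', -, hpp'⟩ := unitaryMonomials_exists_inv hp
  obtain ⟨q', hq', hqq'⟩ := unitaryMonomials_exists_inv hq
  have hinj := IsFractionRing.injective ℂ[T;T⁻¹] Ct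
  have hne {x : ℂ[T;T⁻¹]} (hx : x ≠ 0) : algebraMap ℂ[T;T⁻¹] Ct x ≠ 0 :=
    (map_ne_zero_iff _ hinj).2 hx
  have hX' := hne (mul_ne_zero (left_ne_zero_of_mul_eq_one hpp') hX)
  have hA' := hne (mul_ne_zero (left_ne_zero_of_mul_eq_one hqq') hA)
  rw [← hpX] at hX'
  rw [← hqA] at hA'
  simp only [IsMilnorReidemeisterTorsion, ← coe_preferredBasis]
  refine ⟨exists_isTorsion _ _ _ _ _ (splitAt j) hX' hA', fun τ hτ => ?_⟩
  obtain ⟨s, rfl⟩ := hτ.eq_sign_mul_div _ _ _ _ _ (splitAt j)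
    (rationalComap_comp_eq_zero ε ρ _ _ (boundary₁_comp_boundary₂ P)) hX' hA'
  -- The indeterminacy combines the sign from the enumerations with the quotient of the monomials by
  -- which the lifts alter the two minors.
  refine ⟨(s : ℤ) * (p * q'), mul_mem (intCast_units_mem_unitaryMonomials s) (mul_mem hp hq'), ?_⟩
  rw [hpX, hqA, twistedAlexander, inv_div, map_mul, map_mul, map_mul, map_mul, map_intCast]
  have h1 : algebraMap ℂ[T;T⁻¹] Ct q * algebraMap ℂ[T;T⁻¹] Ct q' = 1 := by
    rw [← map_mul, hqq', map_one]
  have h2 := left_ne_zero_of_mul_eq_one h1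
  have h3 := hne hA
  field_simp
  linear_combination (-((s : ℤ) : Ct) * algebraMap ℂ[T;T⁻¹] Ct p *
    algebraMap ℂ[T;T⁻¹] Ct (genMatrix P ε ρ v j).det) * h1

end PreferredDeterminants

end

end KnotTorsion

theorem theorem4p1 (K : Set S3) (hK : IsKnot K) (x₀ : (Kᶜ : Set S3)) (n : ℕ)
    (P : WirtingerPresentation (FundamentalGroup (Kᶜ : Set S3) x₀) n)
    (ε : FundamentalGroup (Kᶜ : Set S3) x₀ →* Multiplicative ℤ) (hε : Function.Surjective ε)
    {V : Type*} [NormedAddCommGroup V] [InnerProductSpace ℂ V]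
    (ρ : FundamentalGroup (Kᶜ : Set S3) x₀ →* (V ≃ₗᵢ[ℂ] V))
    (m : ℕ) (v : OrthonormalBasis (Fin m) ℂ V)
    (hfin : FiniteHomology P ε ρ)
    (g₀ : Fin 1 → FundamentalGroup (Kᶜ : Set S3) x₀)
    (g₁ : Fin (n + 1) → FundamentalGroup (Kᶜ : Set S3) x₀)
    (g₂ : Fin n → FundamentalGroup (Kᶜ : Set S3) x₀) (j : Fin (n + 1)) :
    (genMatrix P ε ρ v j).det ≠ 0 ∧ (alexanderMatrix P ε ρ v j).det ≠ 0 ∧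
    (∃ τ : Ct, IsMilnorReidemeisterTorsion P ε ρ g₀ g₁ g₂ v τ) ∧
    ∀ τ : Ct, IsMilnorReidemeisterTorsion P ε ρ g₀ g₁ g₂ v τ →
      ∃ (z : ℂ) (l : ℤ), ‖z‖ = 1 ∧
        τ = algebraMap ℂ[T;T⁻¹] Ct (LaurentPolynomial.C z * LaurentPolynomial.T l) *
          (twistedAlexander P ε ρ v j)⁻¹ := by
  have hX := det_genMatrix_ne_zero P ε ρ v hε j
  have hA := det_alexanderMatrix_ne_zero P ε ρ v hε hfin j
  obtain ⟨hex, huniq⟩ := exists_isMilnorReidemeisterTorsion P ε ρ v g₀ g₁ g₂ j hX hA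
  refine ⟨hX, hA, hex, fun τ hτ => ?_⟩
  obtain ⟨_, ⟨z, l, hz, rfl⟩, h⟩ := huniq τ hτ
  exact ⟨z, l, hz, h⟩
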